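/- Let $q>0$ and $k=2q+1$. Let $w_q=W_k$ denote the wheel with $k$ spokes (a rim cycle of length $k$ together with a hub joined to every rim vertex), so that $w_1=W_3=K_4$. Take one wheel $w_q$ with rim vertices $x_0,\dots,x_{k-1}$ in cyclic order, and $k$ wheels $S_0,\dots,S_{k-1}$, each a copy of $w_1$, with indices taken modulo $k$. In each $S_i$ choose two spikes (spokes) and one rim edge that do not form a triangle: the spikes $a_ib_i$ and $b_ic_i$, where $b_i$ is the hub of $S_i$, and the rim edge $c_id_i$. Place the wheels so that for every $i$ - the middle spike $b_ic_i$ of $S_i$ is the rim edge $x_ix_{i+1}$ of $w_q$; - the rim edge $c_id_i$ of $S_i$ is the spike $a_{i+1}b_{i+1}$ of $S_{i+1}$; - apart from this the wheels do not overlap: $S_i$ meets $w_q$ only in the two ends of $b_ic_i$, $S_i$ meets $S_{i+1}$ only in the two ends of $c_id_i$, and any two other small wheels are disjoint. Let $G$ be the edge sum modulo two of these $k+1$ wheels: its vertices are all vertices of the wheels, and its edges are those that belong to an odd number of the wheels. (Thus each $w_1$ loses two edges in common with its two neighbours in the cyclic sequence of small wheels and one edge in common with $w_q$, and $w_q$ loses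 its $k$ rim edges.) Then: 1. $G$ is 4-critical: $\chi(G)=4$, and every proper subgraph of $G$ has chromatic number less than $4$. 2. $G$ quadrangulates the real projective plane: $G$ embeds in it so that every face is an open disc bounded by a 4-cycle of $G$ (the closed face being a closed disc). 3. The graphs that arise in this way are, up to isomorphism, exactly the Mycielski graphs of the odd cycles $C_{2q+1}$. For $q=1$ this is the base graph $w_{111}$ (the edge sum modulo two of three copies of $W_3$ that have one vertex in common and of which any two overlap in exactly one edge, the three overlap edges being distinct and all incident with the common vertex), and for $q=2$ it is the Grötzsch graph. -/

import Mathlib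

open scoped unitInterval

/-- The wheel with `n` spokes: a cycle of length `n` (the rim, on the vertices `some i`)
together with one further vertex `none` (the hub) joined to all rim vertices.
For `n = 3` this is the wheel on four vertices, the complete graph on them. -/
def wheelGraph (n : ℕ) : SimpleGraph (Option (Fin n)) where
  Adj
    | none, none => False
    | none, some _ => True
    | some _, none => True
    | some i, some j => (SimpleGraph.cycleGraph n).Adj i j
  symm := ⟨by
    rintro (_ | i) (_ | j) h
    · exact h
    · trivial
    · trivial
    · exact SimpleGraph.Adj.symm h⟩
  loopless := ⟨by
    rintro (_ | i) h
    · exact h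
    · exact SimpleGraph.irrefl _ h⟩

/-- Sum modulo two of the edge sets of a finite family of graphs on a common vertex set: an edge
survives exactly when it lies in an odd number of members of the family. -/
def edgeSumModTwo {ι V : Type*} (H : ι → SimpleGraph V) : SimpleGraph V where
  Adj u v := Odd {i | (H i).Adj u v}.ncard
  symm := ⟨by
    intro u v h
    simpa only [SimpleGraph.adj_comm] using h⟩
  loopless := ⟨by
    intro v h
    simp at h⟩

/-- The multiwheel pattern for `k w₁ + w_q`, `k = 2q + 1`. The map `c` places one central wheel with
`k` spokes on `V`, and `s i` places the `i`-th of `k` wheels with three spokes, for `i` in the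
cyclically ordered set `Fin k`.

In each small wheel three edges are chosen: two spikes `{none, some 0}` and `{none, some 1}`, and
the rim edge `{some 1, some 2}`, which do not form a triangle. The middle one, `{none, some 1}`,
is matched with a rim edge of the central wheel; the two others are matched with edges of the two
neighbouring small wheels. Apart from that the wheels have no vertices in common. -/
structure IsMultiwheelPattern {V : Type*} (q : ℕ) (c : Option (Fin (2 * q + 1)) ↪ V)
    (s : Fin (2 * q + 1) → (Option (Fin 3) ↪ V)) : Prop where
  /-- Every vertex of `V` belongs to one of the wheels. -/
  cover : Set.range c ∪ (⋃ i, Set.range (s i)) = Set.univ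
  /-- The middle spike of the `i`-th small wheel is the `i`-th rim edge of the central wheel. -/
  middle : ∀ i, s(s i none, s i (some 1)) = s(c (some i), c (some (i + 1)))
  /-- The chosen rim edge of each small wheel is the first chosen spike of the next one. -/
  cyclic : ∀ i, s(s i (some 1), s i (some 2)) = s(s (i + 1) none, s (i + 1) (some 0))
  /-- A small wheel meets the central wheel only in the ends of their matched edge. -/
  meet_central : ∀ i, Set.range (s i) ∩ Set.range c = {s i none, s i (some 1)}
  /-- Two consecutive small wheels meet only in the ends of their matched edge. -/
  meet_next : ∀ i, Set.range (s i) ∩ Set.range (s (i + 1)) = {s i (some 1), s i (some 2)}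
  /-- Other pairs of small wheels are disjoint. -/
  disjoint : ∀ i j, i ≠ j → j ≠ i + 1 → i ≠ j + 1 → Disjoint (Set.range (s i)) (Set.range (s j))

/-- `G` arises from `k` wheels `w₁` and one wheel `w_q`, `k = 2q + 1`, as their edge sum modulo two
according to the multiwheel pattern. -/
def IsGrotzschClass {V : Type*} (q : ℕ) (G : SimpleGraph V) : Prop :=
  ∃ (c : Option (Fin (2 * q + 1)) ↪ V) (s : Fin (2 * q + 1) → (Option (Fin 3) ↪ V)),
    IsMultiwheelPattern q c s ∧
      G = edgeSumModTwo (fun o : Option (Fin (2 * q + 1)) =>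
        match o with
        | none => (wheelGraph (2 * q + 1)).map c
        | some i => (wheelGraph 3).map (s i))

/-- `G` is `n`-critical: it has chromatic number `n`, and every proper subgraph (obtained by deleting
edges or vertices) has a smaller chromatic number. -/
def IsCriticalGraph {V : Type*} (n : ℕ) (G : SimpleGraph V) : Prop :=
  G.chromaticNumber = n ∧ ∀ H : G.Subgraph, H ≠ ⊤ → H.coe.chromaticNumber < n

/-- The Mycielski graph of `G`: the vertices are the vertices `v` of `G` (`inl v`), a copy `v'` of
each of them (`inr (some v)`), and an apex (`inr none`). The copy `v'` is adjacent to the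
neighbours of `v` in `G` and to the apex. -/
def mycielskiGraph {V : Type*} (G : SimpleGraph V) : SimpleGraph (V ⊕ Option V) where
  Adj
    | .inl u, .inl v => G.Adj u v
    | .inl u, .inr (some v) => G.Adj u v
    | .inr (some u), .inl v => G.Adj u v
    | .inr (some _), .inr none => True
    | .inr none, .inr (some _) => True
    | _, _ => False
  symm := ⟨by
    rintro (u | _ | u) (v | _ | v) h <;> first | exact h | exact SimpleGraph.Adj.symm h⟩
  loopless := ⟨by
    rintro (u | _ | u) h
    · exact SimpleGraph.irrefl _ h
    · exact h
    · exact h⟩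

/-- The base graph: the edge sum modulo two of three wheels with three spokes (complete graphs on
four vertices) that have one vertex `0` in common and of which any two overlap in exactly one edge,
`{0, 1}`, `{0, 2}` or `{0, 3}`. -/
def baseGraph : SimpleGraph (Fin 7) :=
  edgeSumModTwo (fun i : Fin 3 =>
    SimpleGraph.fromRel (fun u v : Fin 7 =>
      u ∈ (![{0, 1, 2, 4}, {0, 2, 3, 5}, {0, 3, 1, 6}] i : Finset (Fin 7)) ∧
      v ∈ (![{0, 1, 2, 4}, {0, 2, 3, 5}, {0, 3, 1, 6}] i : Finset (Fin 7))))

/-- The Grötzsch graph, by its list of 20 edges on 11 vertices. -/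
def grotzschGraph : SimpleGraph (Fin 11) :=
  SimpleGraph.fromEdgeSet
    {s(0, 1), s(1, 2), s(2, 3), s(3, 4), s(4, 0),
     s(5, 1), s(5, 4), s(6, 2), s(6, 0), s(7, 3), s(7, 1), s(8, 4), s(8, 2), s(9, 0), s(9, 3),
     s(10, 5), s(10, 6), s(10, 7), s(10, 8), s(10, 9)}

/-- Antipodal points of the unit sphere in three-dimensional Euclidean space are identified. -/
def antipodalSetoid : Setoid (Metric.sphere (0 : EuclideanSpace ℝ (Fin 3)) 1) where
  r x y := x = y ∨ x = -y
  iseqv := by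
    refine ⟨fun x => Or.inl rfl, ?_, ?_⟩
    · rintro x y (rfl | rfl)
      · exact Or.inl rfl
      · exact Or.inr (neg_neg y).symm
    · rintro x y z (rfl | rfl) (rfl | rfl)
      · exact Or.inl rfl
      · exact Or.inr rfl
      · exact Or.inr rfl
      · exact Or.inl (neg_neg z)

/-- The real projective plane, with the quotient topology of the sphere. -/
abbrev RealProjectivePlane : Type := Quotient antipodalSetoid

/-- A drawing without crossings (a topological embedding) of a finite graph `G` in a space `X`:
vertices are distinct points, every edge is a simple arc joining its two ends, and an arc meets
the vertices and the other arcs in its ends only. -/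
structure GraphDrawing {V : Type*} (G : SimpleGraph V) (X : Type*) [TopologicalSpace X] where
  point : V → X
  point_injective : Function.Injective point
  arc : G.edgeSet → C(I, X)
  arc_isEmbedding : ∀ e, Topology.IsEmbedding (arc e)
  arc_ends : ∀ e, s(arc e 0, arc e 1) = (e : Sym2 V).map point
  arc_avoids : ∀ e, Disjoint (arc e '' Set.Ioo 0 1) (Set.range point)
  arc_disjoint : ∀ e f, e ≠ f → Disjoint (arc e '' Set.Ioo 0 1) (arc f '' Set.Ioo 0 1)

/-- The union of all vertices and edges of a drawing. -/
def GraphDrawing.carrier {V : Type*} {G : SimpleGraph V} {X : Type*} [TopologicalSpace X]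
    (D : GraphDrawing G X) : Set X :=
  Set.range D.point ∪ ⋃ e, Set.range (D.arc e)

/-- The faces of a drawing: the connected components of the complement of the drawn graph. -/
def GraphDrawing.IsFace {V : Type*} {G : SimpleGraph V} {X : Type*} [TopologicalSpace X]
    (D : GraphDrawing G X) (F : Set X) : Prop :=
  ∃ x ∈ D.carrierᶜ, F = connectedComponentIn D.carrierᶜ x

/-- `G` quadrangulates `X`: it can be drawn in `X` such that every face is bounded by a cycle of
length four of `G`, that is, the face is the homeomorphic image of the interior of a square under
an embedding of the closed square that takes the boundary of the square onto the cycle. -/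
def Quadrangulates {V : Type*} (G : SimpleGraph V) (X : Type*) [TopologicalSpace X] : Prop :=
  ∃ D : GraphDrawing G X, ∀ F, D.IsFace F →
    ∃ (v : V) (p : G.Walk v v) (φ : C(I × I, X)),
      p.IsCycle ∧ p.length = 4 ∧ Topology.IsEmbedding φ ∧
      φ '' (Set.Ioo 0 1 ×ˢ Set.Ioo 0 1) = F ∧
      φ '' (Set.Ioo 0 1 ×ˢ Set.Ioo 0 1)ᶜ =
        ⋃ e ∈ {e : G.edgeSet | (e : Sym2 V) ∈ p.edges}, Set.range (D.arc e)

/-! The pattern determines the graph. Write `x_i` for the rim of the central wheel and `y_i` for the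
vertex `s i (some 0)`. The overlap conditions force `S_i` to be the complete graph on `x_i, y_i,
x_{i+1}, y_{i+1}` (`IsMultiwheelPattern.range_eq`). Modulo two, `x_i y_i` cancels between `S_{i-1}`
and `S_i`, and `x_i x_{i+1}` cancels between `S_i` and the central wheel. What survives are the
cycle of the `y_i`, the edges `x_i y_{i±1}` and the spokes at the hub: the Mycielski graph of the
cycle, with `x_i` as copy of `y_i` and the hub as apex. Conversely, the wheels can be placed on the
vertices of that graph, which gives `isGrotzschClass_iff`; the other claims then concern only the
Mycielski graph of an odd cycle.

Criticality: the Mycielski construction raises the chromatic number by one, so 3 becomes 4. There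
are no isolated vertices, so it suffices to 3-colour the graph minus one edge; there are four types
of edges, each with an explicit colouring (`exists_coloring_of_edge`).

Quadrangulation: take the projective plane as a disc with antipodal boundary points identified, and
measure angles in units of `π / k`. Put the apex at the centre, the cycle on the boundary circle at
the integer angles, and the copies at radius `1 / 2` at the even angles. A half turn is `k` units,
so the boundary closes up to a `k`-cycle; as `k` is odd, the `k` even angles modulo `2 * k`
represent each residue modulo `k` once. The edges from copies to the cycle form a zigzag, the graph
of a triangle wave. Below it lie `k` cells around the apex, above it `k` cells along the boundary,
and all are quadrangles. Explicit parametrizations of closed cells that cover the plane identify the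
faces without a Jordan curve argument. -/

/-! ### Topology and polar coordinates of the projective plane. -/

instance : T2Space RealProjectivePlane := by
  -- The matrix of products `x i * x j` does not see the sign of `x` and determines the line: equal
  -- matrices give `x = ⟨x, y⟩ y`, and unit length forces `⟨x, y⟩ = ±1`. The Hausdorff property
  -- turns continuous injections of compact sets into embeddings.
  let g : RealProjectivePlane → Fin 3 → Fin 3 → ℝ :=
    Quotient.lift (fun x i j => x.1 i * x.1 j) (by
      rintro x y (rfl | rfl)
      · rfl
      · ext i j
        simp)
  refine T2Space.of_injective_continuous (f := g) ?_ ?_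
  · rintro ⟨x⟩ ⟨y⟩ h
    replace h : ∀ i j, x.1 i * x.1 j = y.1 i * y.1 j := fun i j => congrFun (congrFun h i) j
    have hn : ∀ z : Metric.sphere (0 : EuclideanSpace ℝ (Fin 3)) 1,
        z.1 0 * z.1 0 + z.1 1 * z.1 1 + z.1 2 * z.1 2 = 1 := by
      intro z
      have := EuclideanSpace.real_norm_sq_eq z.1
      rw [mem_sphere_zero_iff_norm.1 z.2, Fin.sum_univ_three] at this
      linarith
    have hs : ∀ i, (x.1 0 * y.1 0 + x.1 1 * y.1 1 + x.1 2 * y.1 2) * y.1 i = x.1 i := by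
      intro i
      linear_combination (-x.1 0) * h 0 i - x.1 1 * h 1 i - x.1 2 * h 2 i + x.1 i * hn x
    generalize x.1 0 * y.1 0 + x.1 1 * y.1 1 + x.1 2 * y.1 2 = t at hs
    have ht : (t - 1) * (t + 1) = 0 := by
      linear_combination hn x - t ^ 2 * hn y + (t * y.1 0 + x.1 0) * hs 0 +
        (t * y.1 1 + x.1 1) * hs 1 + (t * y.1 2 + x.1 2) * hs 2
    refine Quotient.sound ?_
    rcases mul_eq_zero.1 ht with h1 | h1
    · left
      ext i
      rw [← hs i, sub_eq_zero.1 h1, one_mul]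
    · right
      ext i
      rw [← hs i, eq_neg_of_add_eq_zero_left h1]
      simp
  · refine Continuous.quotient_lift (by fun_prop) _

/-- The line through the point of the unit sphere with polar angle `a` and azimuth `b`. -/
noncomputable def sphericalPoint (a b : ℝ) : RealProjectivePlane :=
  Quotient.mk _ ⟨!₂[Real.sin a * Real.cos b, Real.sin a * Real.sin b, Real.cos a], by
    rw [mem_sphere_zero_iff_norm, EuclideanSpace.norm_eq, Real.sqrt_eq_one, Fin.sum_univ_three]
    simp only [Real.norm_eq_abs, sq_abs, Matrix.cons_val]
    linear_combination Real.sin a ^ 2 * Real.sin_sq_add_cos_sq b + Real.sin_sq_add_cos_sq a⟩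

/-- At the pole the azimuth is multiplied out: `sin a` tends to zero while cosine and sine of `b`
stay bounded. The cells at the apex need this, since their angle has no limit there. -/
theorem continuous_sphericalPoint {A : Type*} [TopologicalSpace A] {a b : A → ℝ}
    (ha : Continuous a) (hb : ∀ x, Real.sin (a x) ≠ 0 → ContinuousAt b x) :
    Continuous fun x => sphericalPoint (a x) (b x) := by
  have key : ∀ f : ℝ → ℝ, Continuous f → (∀ y, |f y| ≤ 1) →
      Continuous fun x => Real.sin (a x) * f (b x) := by
    intro f hf hf1
    rw [continuous_iff_continuousAt]
    intro x
    by_cases hx : Real.sin (a x) = 0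
    · have h0 : Filter.Tendsto (fun x => |Real.sin (a x)|) (nhds x) (nhds 0) := by
        have : Continuous fun x => |Real.sin (a x)| := by fun_prop
        simpa [hx] using this.tendsto x
      change Filter.Tendsto _ _ (nhds (Real.sin (a x) * f (b x)))
      rw [hx, zero_mul]
      refine squeeze_zero_norm (fun y => ?_) h0
      rw [norm_mul, Real.norm_eq_abs, Real.norm_eq_abs]
      exact mul_le_of_le_one_right (abs_nonneg _) (hf1 _)
    · exact (Real.continuous_sin.comp ha).continuousAt.mul (hf.continuousAt.comp (hb x hx))
  refine continuous_quotient_mk'.comp (Continuous.subtype_mk ?_ _)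
  refine (PiLp.continuous_toLp 2 _).comp (continuous_pi fun i => ?_)
  fin_cases i
  · exact key _ Real.continuous_cos Real.abs_cos_le_one
  · exact key _ Real.continuous_sin Real.abs_sin_le_one
  · exact Real.continuous_cos.comp ha

theorem exists_sphericalPoint (x : RealProjectivePlane) :
    ∃ a ∈ Set.Icc 0 (Real.pi / 2), ∃ b, sphericalPoint a b = x := by
  have key : ∀ v : Metric.sphere (0 : EuclideanSpace ℝ (Fin 3)) 1, 0 ≤ v.1 2 →
      ∃ a ∈ Set.Icc 0 (Real.pi / 2), ∃ b, sphericalPoint a b = Quotient.mk _ v := by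
    intro v hv
    have hn : v.1 0 ^ 2 + v.1 1 ^ 2 + v.1 2 ^ 2 = 1 := by
      have := EuclideanSpace.real_norm_sq_eq v.1
      rw [mem_sphere_zero_iff_norm.1 v.2, Fin.sum_univ_three] at this
      linarith
    have h1 : v.1 2 ≤ 1 := by nlinarith [sq_nonneg (v.1 0), sq_nonneg (v.1 1)]
    refine ⟨Real.arccos (v.1 2), ⟨Real.arccos_nonneg _, Real.arccos_le_pi_div_two.2 hv⟩,
      Complex.arg ⟨v.1 0, v.1 1⟩, ?_⟩
    have hr : Real.sin (Real.arccos (v.1 2)) = ‖(⟨v.1 0, v.1 1⟩ : ℂ)‖ := by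
      rw [Real.sin_arccos, Complex.norm_eq_sqrt_sq_add_sq]
      congr 1
      simp only
      linarith
    refine congrArg (Quotient.mk _) (Subtype.ext ?_)
    ext i
    fin_cases i
    · simp [hr]
    · simp [hr]
    · simpa using Real.cos_arccos (by linarith) h1
  induction x using Quotient.inductionOn with
  | h v =>
    rcases le_total 0 (v.1 2) with hv | hv
    · exact key v hv
    · have : Quotient.mk antipodalSetoid v = Quotient.mk _ (-v) := Quotient.sound (Or.inr (by simp))
      rw [this]
      exact key (-v) (by simpa using hv)

theorem sphericalPoint_add_two_pi (a b : ℝ) (n : ℤ) :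
    sphericalPoint a (b + n * (2 * Real.pi)) = sphericalPoint a b := by
  simp only [sphericalPoint, Real.cos_add_int_mul_two_pi, Real.sin_add_int_mul_two_pi]

theorem sphericalPoint_zero (b b' : ℝ) : sphericalPoint 0 b = sphericalPoint 0 b' := by
  simp only [sphericalPoint, Real.sin_zero, zero_mul]

theorem sphericalPoint_pi_div_two_add_pi (b : ℝ) :
    sphericalPoint (Real.pi / 2) (b + Real.pi) = sphericalPoint (Real.pi / 2) b := by
  refine Quotient.sound (Or.inr (Subtype.ext ?_))
  ext i
  fin_cases i <;> simp [Real.cos_add_pi, Real.sin_add_pi]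

theorem exists_eq_add_of_cos_sin_eq {b b' : ℝ} (hc : Real.cos b' = Real.cos b)
    (hs : Real.sin b' = Real.sin b) : ∃ n : ℤ, b' = b + n * (2 * Real.pi) := by
  obtain ⟨n, hn⟩ := Real.Angle.angle_eq_iff_two_pi_dvd_sub.1 (Real.Angle.cos_sin_inj hc hs)
  exact ⟨n, by linarith⟩

/-- Both representatives lie in the closed upper hemisphere. If they are antipodal, their heights
are nonnegative and opposite, hence zero, so both points are on the equator. -/
theorem eq_of_sphericalPoint_eq {a b a' b' : ℝ} (ha : a ∈ Set.Icc 0 (Real.pi / 2))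
    (ha' : a' ∈ Set.Icc 0 (Real.pi / 2)) (h : sphericalPoint a b = sphericalPoint a' b') :
    a = a' ∧ (a = 0 ∨ (∃ n : ℤ, b' = b + n * (2 * Real.pi)) ∨
      (a = Real.pi / 2 ∧ ∃ n : ℤ, b' = b + n * Real.pi)) := by
  have hpi := Real.pi_pos
  have inj : Real.cos a = Real.cos a' → a = a' := fun h =>
    Real.injOn_cos ⟨ha.1, by linarith [ha.2]⟩ ⟨ha'.1, by linarith [ha'.2]⟩ h
  rcases Quotient.exact h with h | h
  · have h0 := congrArg (fun v => v.1 0) h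
    have h1 := congrArg (fun v => v.1 1) h
    have h2 := congrArg (fun v => v.1 2) h
    simp at h0 h1 h2
    obtain rfl := inj h2
    refine ⟨rfl, ?_⟩
    rcases ha.1.eq_or_lt with h3 | h3
    · exact Or.inl h3.symm
    have hsin : Real.sin a ≠ 0 := (Real.sin_pos_of_pos_of_lt_pi h3 (by linarith [ha.2])).ne'
    exact Or.inr (Or.inl (exists_eq_add_of_cos_sin_eq (by simpa [hsin] using h0.symm)
      (by simpa [hsin] using h1.symm)))
  · have h0 := congrArg (fun v => v.1 0) h
    have h1 := congrArg (fun v => v.1 1) h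
    have h2 := congrArg (fun v => v.1 2) h
    simp at h0 h1 h2
    have hc : 0 ≤ Real.cos a := Real.cos_nonneg_of_mem_Icc ⟨by linarith [ha.1], ha.2⟩
    have hc' : 0 ≤ Real.cos a' := Real.cos_nonneg_of_mem_Icc ⟨by linarith [ha'.1], ha'.2⟩
    obtain rfl := inj (by linarith)
    have h3 : a = Real.pi / 2 :=
      Real.injOn_cos ⟨ha.1, by linarith [ha.2]⟩ ⟨by linarith, by linarith⟩
        (by rw [Real.cos_pi_div_two]; linarith)
    subst h3
    rw [Real.sin_pi_div_two, one_mul, one_mul] at h0 h1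
    obtain ⟨n, hn⟩ := exists_eq_add_of_cos_sin_eq (b := b + Real.pi) (b' := b')
      (by rw [Real.cos_add_pi]; linarith) (by rw [Real.sin_add_pi]; linarith)
    exact ⟨rfl, Or.inr (Or.inr ⟨rfl, 2 * n + 1, by push_cast; linarith⟩)⟩

/-- Polar coordinates on the projective plane, regarded as a disc of radius one whose antipodal
boundary points are identified. The angle is measured in units of `π / k`. -/
noncomputable def polarPoint (k : ℕ) (r θ : ℝ) : RealProjectivePlane :=
  sphericalPoint (Real.pi / 2 * r) (Real.pi / k * θ)

section Polar

variable {k : ℕ}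

theorem continuous_polarPoint {A : Type*} [TopologicalSpace A] {r θ : A → ℝ}
    (hr : Continuous r) (hθ : ∀ x, r x ≠ 0 → ContinuousAt θ x) :
    Continuous fun x => polarPoint k (r x) (θ x) := by
  refine continuous_sphericalPoint (by fun_prop) fun x hx => ?_
  refine ContinuousAt.mul continuousAt_const (hθ x fun h => hx ?_)
  rw [h, mul_zero, Real.sin_zero]

theorem polarPoint_zero (θ θ' : ℝ) : polarPoint k 0 θ = polarPoint k 0 θ' := by
  simp only [polarPoint, mul_zero]
  exact sphericalPoint_zero _ _

theorem exists_polarPoint (hk : 0 < k) (x : RealProjectivePlane) :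
    ∃ r ∈ Set.Icc (0 : ℝ) 1, ∃ θ, polarPoint k r θ = x := by
  obtain ⟨a, ha, b, rfl⟩ := exists_sphericalPoint x
  have hpi := Real.pi_pos
  have hk' : (k : ℝ) ≠ 0 := by positivity
  refine ⟨a / (Real.pi / 2), ⟨div_nonneg ha.1 (by positivity), ?_⟩, b / (Real.pi / k), ?_⟩
  · rw [div_le_one (by positivity)]
    exact ha.2
  · unfold polarPoint
    congr 1 <;> field_simp

theorem polarPoint_add (hk : 0 < k) (r θ : ℝ) (n : ℤ) :
    polarPoint k r (θ + 2 * k * n) = polarPoint k r θ := by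
  have hk' : (k : ℝ) ≠ 0 := by positivity
  unfold polarPoint
  rw [← sphericalPoint_add_two_pi _ (Real.pi / k * θ) n]
  congr 1
  field_simp

/-- On the boundary circle a half turn is the antipodal identification, so the boundary has period
`k` instead of `2 * k`. -/
theorem polarPoint_one_add (hk : 0 < k) (θ : ℝ) (n : ℤ) :
    polarPoint k 1 (θ + k * n) = polarPoint k 1 θ := by
  have hk' : (k : ℝ) ≠ 0 := by positivity
  have h1 : ∀ θ : ℝ, polarPoint k 1 (θ + k) = polarPoint k 1 θ := by
    intro θ
    unfold polarPoint
    rw [mul_one, ← sphericalPoint_pi_div_two_add_pi (Real.pi / k * θ)]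
    congr 1
    field_simp
  rcases Int.even_or_odd' n with ⟨m, rfl | rfl⟩
  · rw [← polarPoint_add hk 1 θ m]
    congr 1
    push_cast
    ring
  · rw [← polarPoint_add hk 1 θ m, ← h1 (θ + 2 * k * m)]
    congr 1
    push_cast
    ring

/-- All injectivity and disjointness claims about the drawing reduce to this list of ambiguities:
the centre, full turns, and half turns on the boundary. -/
theorem eq_of_polarPoint_eq (hk : 0 < k) {r θ r' θ' : ℝ} (hr : r ∈ Set.Icc (0 : ℝ) 1)
    (hr' : r' ∈ Set.Icc (0 : ℝ) 1) (h : polarPoint k r θ = polarPoint k r' θ') :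
    r' = r ∧ (r = 0 ∨ (∃ n : ℤ, θ' = θ + 2 * k * n) ∨ (r = 1 ∧ ∃ n : ℤ, θ' = θ + k * n)) := by
  have hpi := Real.pi_pos
  have hk' : (0 : ℝ) < k := by positivity
  have mem : ∀ {r : ℝ}, r ∈ Set.Icc (0 : ℝ) 1 →
      Real.pi / 2 * r ∈ Set.Icc 0 (Real.pi / 2) := fun hr =>
    ⟨mul_nonneg (by positivity) hr.1, mul_le_of_le_one_right (by positivity) hr.2⟩
  obtain ⟨h1, h2⟩ := eq_of_sphericalPoint_eq (mem hr) (mem hr') h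
  refine ⟨(mul_left_cancel₀ (by positivity) h1).symm, ?_⟩
  rcases h2 with h2 | ⟨n, hn⟩ | ⟨h2, n, hn⟩
  · exact Or.inl ((mul_eq_zero.1 h2).resolve_left (by positivity))
  · refine Or.inr (Or.inl ⟨n, ?_⟩)
    have : Real.pi / k * θ' = Real.pi / k * (θ + 2 * k * n) := by
      rw [hn]
      field_simp
    exact mul_left_cancel₀ (by positivity) this
  · refine Or.inr (Or.inr ⟨mul_left_cancel₀ (show Real.pi / 2 ≠ 0 by positivity) (by linarith),
      n, ?_⟩)
    have : Real.pi / k * θ' = Real.pi / k * (θ + k * n) := by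
      rw [hn]
      field_simp
    exact mul_left_cancel₀ (by positivity) this

end Polar

theorem mem_compl_openSquare {z : I × I} :
    z ∈ (Set.Ioo (0 : I) 1 ×ˢ Set.Ioo (0 : I) 1)ᶜ ↔ z.1 = 0 ∨ z.1 = 1 ∨ z.2 = 0 ∨ z.2 = 1 := by
  rw [Set.mem_compl_iff, Set.mem_prod, Set.mem_Ioo, Set.mem_Ioo, unitInterval.pos_iff_ne_zero,
    unitInterval.pos_iff_ne_zero, unitInterval.lt_one_iff_ne_one, unitInterval.lt_one_iff_ne_one]
  tauto

theorem image_compl_openSquare {X : Type*} (φ : I × I → X) :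
    φ '' (Set.Ioo (0 : I) 1 ×ˢ Set.Ioo (0 : I) 1)ᶜ =
      Set.range (fun t => φ (t, 0)) ∪ Set.range (fun t => φ (0, t)) ∪
        Set.range (fun t => φ (1, t)) ∪ Set.range (fun t => φ (t, 1)) := by
  ext x
  constructor
  · rintro ⟨⟨s, t⟩, hz, rfl⟩
    rcases mem_compl_openSquare.1 hz with h | h | h | h <;> simp only at h <;> subst h
    · exact Or.inl (Or.inl (Or.inr ⟨t, rfl⟩))
    · exact Or.inl (Or.inr ⟨t, rfl⟩)
    · exact Or.inl (Or.inl (Or.inl ⟨s, rfl⟩))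
    · exact Or.inr ⟨s, rfl⟩
  · rintro (((⟨t, rfl⟩ | ⟨t, rfl⟩) | ⟨t, rfl⟩) | ⟨t, rfl⟩) <;>
      exact ⟨_, mem_compl_openSquare.2 (by simp), rfl⟩

theorem range_comp_symm {X : Type*} (f : I → X) : Set.range (fun t => f (unitInterval.symm t)) = Set.range f :=
  unitInterval.symm_involutive.surjective.range_comp f

/-! ### Recognizing the components of a complement. -/

section Components

variable {X : Type*} [TopologicalSpace X]

/-- Off `C`, the set `K i` and the union of the other `K j` are disjoint, closed and cover
everything. A connected set off `C` that meets `K i` therefore stays in it, and `K i \ C` is itself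
connected. -/
theorem connectedComponentIn_compl_eq {ι : Type*} [Finite ι] {C : Set X} {K : ι → Set X}
    (hK : ∀ i, IsClosed (K i)) (hconn : ∀ i, IsPreconnected (K i \ C))
    (hdisj : ∀ i j, i ≠ j → Disjoint (K i \ C) (K j \ C)) (hcover : Cᶜ ⊆ ⋃ i, K i)
    {x : X} (hx : x ∉ C) : ∃ i, connectedComponentIn Cᶜ x = K i \ C := by
  obtain ⟨i, hi⟩ := Set.mem_iUnion.1 (hcover hx)
  have hxF : x ∈ connectedComponentIn Cᶜ x := mem_connectedComponentIn hx
  have hFC := connectedComponentIn_subset Cᶜ x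
  refine ⟨i, Set.Subset.antisymm ?_
    ((hconn i).subset_connectedComponentIn ⟨hi, hx⟩ fun y hy => hy.2)⟩
  have key := isPreconnected_iff_subset_of_disjoint_closed.1
    (isPreconnected_connectedComponentIn (x := x) (F := Cᶜ)) (K i) (⋃ j : {j // j ≠ i}, K j)
    (hK i) (isClosed_iUnion_of_finite fun j => hK j) ?_ ?_
  · rcases key with h | h
    · exact fun y hy => ⟨h hy, hFC hy⟩
    · obtain ⟨⟨j, hj⟩, hxj⟩ := Set.mem_iUnion.1 (h hxF)
      exact absurd ⟨hxj, hx⟩ ((Set.disjoint_left.1 (hdisj i j hj.symm)) ⟨hi, hx⟩)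
  · intro y hy
    obtain ⟨j, hj⟩ := Set.mem_iUnion.1 (hcover (hFC hy))
    by_cases hji : j = i
    · exact Or.inl (hji ▸ hj)
    · exact Or.inr (Set.mem_iUnion.2 ⟨⟨j, hji⟩, hj⟩)
  · rw [Set.eq_empty_iff_forall_notMem]
    rintro y ⟨hy, hyi, hyu⟩
    obtain ⟨⟨j, hj⟩, hyj⟩ := Set.mem_iUnion.1 hyu
    exact Set.disjoint_left.1 (hdisj i j hj.symm) ⟨hyi, hFC hy⟩ ⟨hyj, hFC hy⟩

end Components

/-! ### The zigzag curve that separates the inner from the outer cells. -/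

section Wave

/-- The triangle wave of period two that equals `1 / 2` at even and `1` at odd integers. -/
noncomputable def triangleWave (θ : ℝ) : ℝ := 1 / 2 + |θ / 2 - round (θ / 2)|

theorem triangleWave_add (θ : ℝ) (n : ℤ) : triangleWave (θ + 2 * n) = triangleWave θ := by
  have : (θ + 2 * n) / 2 = θ / 2 + n := by ring
  rw [triangleWave, this, round_add_intCast, triangleWave]
  push_cast
  ring_nf

theorem triangleWave_even_add (m : ℤ) {τ : ℝ} (hτ : |τ| ≤ 1) :
    triangleWave (2 * m + τ) = (1 + |τ|) / 2 := by
  rw [add_comm, triangleWave_add, triangleWave, abs_sub_round_eq_min]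
  rw [abs_le] at hτ
  rcases le_or_gt 0 τ with h | h
  · rw [abs_of_nonneg h, Int.fract_eq_self.2 ⟨by linarith, by linarith⟩, min_eq_left] <;> linarith
  · have : Int.fract (τ / 2) = τ / 2 + 1 :=
      Int.fract_eq_iff.2 ⟨by linarith, by linarith, -1, by push_cast; ring⟩
    rw [this, abs_of_neg h, min_eq_right] <;> linarith

/-- The same wave seen from its peaks: inner cells are centred at odd angles, outer cells at even
ones. -/
theorem triangleWave_odd_sub (m : ℤ) {u : ℝ} (hu : |u| ≤ 1) :
    triangleWave (2 * m + 1 - u) = 1 - |u| / 2 := by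
  rw [abs_le] at hu
  rcases le_or_gt 0 u with h | h
  · have : |1 - u| = 1 - u := abs_of_nonneg (by linarith)
    rw [add_sub_assoc, triangleWave_even_add m (by rw [this]; linarith), this, abs_of_nonneg h]
    ring
  · have h1 : |-1 - u| = 1 + u := by rw [abs_of_nonpos (by linarith)]; ring
    have h2 : 2 * (m : ℝ) + 1 - u = 2 * ((m + 1 : ℤ) : ℝ) + (-1 - u) := by push_cast; ring
    rw [h2, triangleWave_even_add _ (by rw [h1]; linarith), h1, abs_of_neg h]
    ring

theorem exists_eq_even_add (θ : ℝ) : ∃ (m : ℤ) (τ : ℝ), |τ| ≤ 1 ∧ θ = 2 * m + τ := by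
  refine ⟨round (θ / 2), θ - 2 * round (θ / 2), ?_, by ring⟩
  have := abs_le.1 (abs_sub_round (θ / 2))
  rw [abs_le]
  constructor <;> linarith [this.1, this.2]

theorem exists_eq_odd_sub (θ : ℝ) : ∃ (m : ℤ) (u : ℝ), |u| ≤ 1 ∧ θ = 2 * m + 1 - u := by
  obtain ⟨m, τ, hτ, h⟩ := exists_eq_even_add (θ - 1)
  exact ⟨m, -τ, by rwa [abs_neg], by linarith⟩

theorem triangleWave_mem (θ : ℝ) : triangleWave θ ∈ Set.Icc (1 / 2 : ℝ) 1 := by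
  obtain ⟨m, τ, hτ, rfl⟩ := exists_eq_even_add θ
  rw [triangleWave_even_add m hτ]
  constructor <;> linarith [abs_nonneg τ]

/-- Polar coordinates of the points of the drawing of the Mycielski graph of a cycle. -/
def IsSkeletal (r θ : ℝ) : Prop :=
  r = 0 ∨ r = 1 ∨ r = triangleWave θ ∨ (r ≤ 1 / 2 ∧ ∃ m : ℤ, θ = 2 * m)

/-- A full turn is `2 * k`, a multiple of the period 2 of the wave. The odd shift by `k` occurs only
at `r = 1`, where every point is skeletal anyway. -/
theorem IsSkeletal.of_polarPoint_eq {k : ℕ} (hk : 0 < k) {r θ r' θ' : ℝ}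
    (hr : r ∈ Set.Icc (0 : ℝ) 1) (hr' : r' ∈ Set.Icc (0 : ℝ) 1)
    (h : polarPoint k r θ = polarPoint k r' θ') (hs : IsSkeletal r θ) : IsSkeletal r' θ' := by
  obtain ⟨rfl, h0 | ⟨n, rfl⟩ | ⟨h1, -⟩⟩ := eq_of_polarPoint_eq hk hr hr' h
  · exact Or.inl h0
  · have hn : θ + 2 * k * n = θ + 2 * ((k * n : ℤ) : ℝ) := by push_cast; ring
    rcases hs with hs | hs | hs | ⟨hs, m, rfl⟩
    · exact Or.inl hs
    · exact Or.inr (Or.inl hs)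
    · exact Or.inr (Or.inr (Or.inl (by rw [hn, triangleWave_add]; exact hs)))
    · exact Or.inr (Or.inr (Or.inr ⟨hs, m + k * n, by push_cast; ring⟩))
  · exact Or.inr (Or.inl h1)

end Wave

/-! ### The drawing of the edges by explicit arcs. -/

/-- The edges of the Mycielski graph of an odd cycle, indexed by integer positions on the cycle: the
edges at the apex, those between a copy and its successor or predecessor on the cycle, and those of
the cycle. -/
inductive Strand
  | spoke (m : ℤ)
  | up (m : ℤ)
  | down (m : ℤ)
  | rim (p : ℤ)

namespace Strand

/-- The vertex at position `p` of the cycle. -/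
def rimVertex (k : ℕ) (p : ℤ) : ZMod k ⊕ Option (ZMod k) := .inl p

/-- The copy of the vertex at position `p` of the cycle. -/
def copyVertex (k : ℕ) (p : ℤ) : ZMod k ⊕ Option (ZMod k) := .inr (some p)

/-- The ends of a strand. -/
def edge (k : ℕ) : Strand → Sym2 (ZMod k ⊕ Option (ZMod k))
  | spoke m => s(.inr none, copyVertex k (2 * m))
  | up m => s(copyVertex k (2 * m), rimVertex k (2 * m + 1))
  | down m => s(copyVertex k (2 * m), rimVertex k (2 * m - 1))
  | rim p => s(rimVertex k p, rimVertex k (p + 1))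

/-- The radius of a point of a strand. -/
noncomputable def radius : Strand → ℝ → ℝ
  | spoke _, t => t / 2
  | up _, t => (1 + t) / 2
  | down _, t => (1 + t) / 2
  | rim _, _ => 1

/-- The angle of a point of a strand. -/
noncomputable def angle : Strand → ℝ → ℝ
  | spoke m, _ => 2 * m
  | up m, t => 2 * m + t
  | down m, t => 2 * m - t
  | rim p, t => p + t

theorem continuous_radius (l : Strand) : Continuous l.radius := by
  cases l <;> unfold radius <;> fun_prop

theorem continuous_angle (l : Strand) : Continuous l.angle := by
  cases l <;> unfold angle <;> fun_prop

theorem radius_mem (l : Strand) (t : I) : l.radius t ∈ Set.Icc (0 : ℝ) 1 := by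
  have h0 := t.2.1
  have h1 := t.2.2
  cases l <;> simp only [radius] <;> constructor <;> linarith

/-- The arc in the projective plane that represents a strand. -/
noncomputable def arc (k : ℕ) (l : Strand) : C(I, RealProjectivePlane) where
  toFun t := polarPoint k (l.radius t) (l.angle t)
  continuous_toFun := continuous_polarPoint (l.continuous_radius.comp continuous_subtype_val)
    fun _ _ => (l.continuous_angle.comp continuous_subtype_val).continuousAt

theorem isSkeletal (l : Strand) (t : I) : IsSkeletal (l.radius t) (l.angle t) := by
  have h0 := t.2.1
  have h1 := t.2.2
  cases l with
  | spoke m => exact Or.inr (Or.inr (Or.inr ⟨by simp only [radius]; linarith, m, rfl⟩))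
  | up m =>
    refine Or.inr (Or.inr (Or.inl ?_))
    simp only [radius, angle]
    rw [triangleWave_even_add _ (by rwa [abs_of_nonneg h0]), abs_of_nonneg h0]
  | down m =>
    refine Or.inr (Or.inr (Or.inl ?_))
    simp only [radius, angle, sub_eq_add_neg]
    rw [triangleWave_even_add _ (by rwa [abs_neg, abs_of_nonneg h0]), abs_neg, abs_of_nonneg h0]
  | rim p => exact Or.inr (Or.inl rfl)

section

variable {k : ℕ}

theorem intCast_add_mul_eq (p n : ℤ) : ((p + k * n : ℤ) : ZMod k) = p := by
  push_cast
  simp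

theorem two_ne_zero_of_le (hk : 3 ≤ k) : (2 : ZMod k) ≠ 0 := by
  intro h
  have : ((2 : ℕ) : ZMod k) = 0 := by exact_mod_cast h
  rw [ZMod.natCast_eq_zero_iff] at this
  have := Nat.le_of_dvd (by norm_num) this
  omega

theorem eq_zero_of_two_mul_eq_zero (hodd : Odd k) {a : ZMod k} (h : 2 * a = 0) : a = 0 := by
  have h2 : IsUnit ((2 : ℕ) : ZMod k) := (ZMod.isUnit_iff_coprime 2 k).2 (Nat.coprime_two_left.2 hodd)
  push_cast at h2
  exact (h2.mul_right_eq_zero).1 h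

theorem exists_eq_two_mul (hodd : Odd k) (a : ZMod k) : ∃ m : ℤ, a = ((2 * m : ℤ) : ZMod k) := by
  obtain ⟨q, rfl⟩ := hodd
  obtain ⟨p, rfl⟩ := ZMod.intCast_surjective a
  refine ⟨(q + 1) * p, ?_⟩
  rw [← intCast_add_mul_eq p p]
  congr 1
  push_cast
  ring

theorem edge_eq_of_mem_Ioo (hk : 3 ≤ k) {l l' : Strand} {t t' : I} (ht : t ∈ Set.Ioo 0 1)
    (ht' : t' ∈ Set.Ioo 0 1) (h : l.arc k t = l'.arc k t') : l.edge k = l'.edge k := by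
  have h0 : 0 < (t : ℝ) := ht.1
  have h1 : (t : ℝ) < 1 := ht.2
  have h0' : 0 < (t' : ℝ) := ht'.1
  have h1' : (t' : ℝ) < 1 := ht'.2
  obtain ⟨hr, hθ⟩ := eq_of_polarPoint_eq (by omega) (l.radius_mem t) (l'.radius_mem t') h
  have key : ∀ p p' n : ℤ, ∀ c : ℝ, |c| < 1 → (p' : ℝ) + c = p + k * n → p' = p + k * n := by
    intro p p' n c hc h
    have hz : ((p + k * n - p' : ℤ) : ℝ) = c := by push_cast; linarith
    rw [← hz, ← Int.cast_abs] at hc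
    have := Int.abs_lt_one_iff.1 (by exact_mod_cast hc)
    linarith
  -- The radius is below `1 / 2` on spokes, strictly between `1 / 2` and `1` on `up` and `down`, and
  -- `1` on the rim. This leaves pairs of the same type, where the angle fixes the label modulo `k`,
  -- and `up` against `down`, where equal radii give equal parameters and the angle would make the
  -- parameter an integer.
  rcases l with m | m | m | p <;> rcases l' with m' | m' | m' | p' <;>
    simp only [radius, angle] at hr hθ <;> try (exfalso; linarith)
  · rcases hθ with hθ | ⟨n, hn⟩ | ⟨hθ, -⟩
    · exfalso; linarith
    · have : 2 * m' = 2 * m + k * (2 * n) := by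
        have : 2 * (m' : ℝ) = 2 * m + k * (2 * n) := by linarith
        exact_mod_cast this
      simp only [edge, copyVertex, this, intCast_add_mul_eq]
    · exfalso; linarith
  · rcases hθ with hθ | ⟨n, hn⟩ | ⟨hθ, -⟩
    · exfalso; linarith
    · have : 2 * m' = 2 * m + k * (2 * n) := by
        have : 2 * (m' : ℝ) = 2 * m + k * (2 * n) := by linarith
        exact_mod_cast this
      have h2 : 2 * m' + 1 = 2 * m + 1 + k * (2 * n) := by rw [this]; ring
      simp only [edge, copyVertex, rimVertex, h2]
      simp only [this, intCast_add_mul_eq]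
    · exfalso; linarith
  · rcases hθ with hθ | ⟨n, hn⟩ | ⟨hθ, -⟩
    · exfalso; linarith
    · have h2 : (2 * t : ℝ) = ((2 * (m' - m - k * n) : ℤ) : ℝ) := by push_cast; linarith
      have h3 : (t : ℝ) = ((m' - m - k * n : ℤ) : ℝ) := by
        push_cast at h2 ⊢
        linarith
      rw [h3] at h0 h1
      have h0 : 0 < m' - m - k * n := by exact_mod_cast h0
      have h1 : m' - m - k * n < 1 := by exact_mod_cast h1
      omega
    · exfalso; linarith
  · rcases hθ with hθ | ⟨n, hn⟩ | ⟨hθ, -⟩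
    · exfalso; linarith
    · have h3 : (t : ℝ) = ((m - m' + k * n : ℤ) : ℝ) := by
        push_cast
        linarith
      rw [h3] at h0 h1
      have h0 : 0 < m - m' + k * n := by exact_mod_cast h0
      have h1 : m - m' + k * n < 1 := by exact_mod_cast h1
      omega
    · exfalso; linarith
  · rcases hθ with hθ | ⟨n, hn⟩ | ⟨hθ, -⟩
    · exfalso; linarith
    · have : 2 * m' = 2 * m + k * (2 * n) := by
        have : 2 * (m' : ℝ) = 2 * m + k * (2 * n) := by linarith
        exact_mod_cast this
      have h2 : 2 * m' - 1 = 2 * m - 1 + k * (2 * n) := by rw [this]; ring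
      simp only [edge, copyVertex, rimVertex, h2]
      simp only [this, intCast_add_mul_eq]
    · exfalso; linarith
  · have : ∃ n : ℤ, p' = p + k * n := by
      have hc : |(t' : ℝ) - t| < 1 := by rw [abs_lt]; constructor <;> linarith
      rcases hθ with hθ | ⟨n, hn⟩ | ⟨-, n, hn⟩
      · exfalso; linarith
      · exact ⟨2 * n, key p p' _ _ hc (by push_cast; linarith)⟩
      · exact ⟨n, key p p' _ _ hc (by linarith)⟩
    obtain ⟨n, rfl⟩ := this
    have h2 : p + k * n + 1 = p + 1 + k * n := by ring
    simp only [edge, rimVertex, h2]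
    simp only [intCast_add_mul_eq]

theorem exists_eq_add_mul {p p' : ℤ} (h : (p : ZMod k) = p') : ∃ n : ℤ, p' = p + k * n := by
  obtain ⟨n, hn⟩ := (ZMod.intCast_eq_intCast_iff_dvd_sub p p' k).1 h
  exact ⟨n, by linarith⟩

theorem exists_eq_add_mul_of_two_mul (hodd : Odd k) {m m' : ℤ}
    (h : ((2 * m : ℤ) : ZMod k) = (2 * m' : ℤ)) : ∃ n : ℤ, m' = m + k * n := by
  refine exists_eq_add_mul (sub_eq_zero.1 (eq_zero_of_two_mul_eq_zero hodd ?_))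
  push_cast at h
  rw [mul_sub, h, sub_self]

theorem arc_spoke_add (hk : 0 < k) (m n : ℤ) : (spoke (m + k * n)).arc k = (spoke m).arc k := by
  ext t
  simp only [arc, radius, angle, ContinuousMap.coe_mk]
  rw [← polarPoint_add hk (t / 2) (2 * m) n]
  congr 1
  push_cast
  ring

theorem arc_up_add (hk : 0 < k) (m n : ℤ) : (up (m + k * n)).arc k = (up m).arc k := by
  ext t
  simp only [arc, radius, angle, ContinuousMap.coe_mk]
  rw [← polarPoint_add hk ((1 + t) / 2) (2 * m + t) n]
  congr 1
  push_cast
  ring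

theorem arc_down_add (hk : 0 < k) (m n : ℤ) : (down (m + k * n)).arc k = (down m).arc k := by
  ext t
  simp only [arc, radius, angle, ContinuousMap.coe_mk]
  rw [← polarPoint_add hk ((1 + t) / 2) (2 * m - t) n]
  congr 1
  push_cast
  ring

theorem arc_rim_add (hk : 0 < k) (p n : ℤ) : (rim (p + k * n)).arc k = (rim p).arc k := by
  ext t
  simp only [arc, radius, angle, ContinuousMap.coe_mk]
  rw [← polarPoint_one_add hk (p + t) n]
  congr 1
  push_cast
  ring

/-- Labels of one edge differ by a multiple of `k`, and the polar coordinates are periodic; a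
coincidence of another kind would give `2 = 0` in `ZMod k`. So the label that `ofEdge` chooses does
not affect the arc. -/
theorem arc_congr (hk : 3 ≤ k) (hodd : Odd k) {l l' : Strand} (h : l.edge k = l'.edge k) :
    l.arc k = l'.arc k := by
  have h2 := two_ne_zero_of_le hk
  have hk0 : 0 < k := by omega
  rcases l with m | m | m | p <;> rcases l' with m' | m' | m' | p' <;>
    simp [edge, copyVertex, rimVertex] at h
  · obtain ⟨n, rfl⟩ := exists_eq_add_mul_of_two_mul (k := k) hodd (m := m) (m' := m')
      (by push_cast; exact h)
    exact (arc_spoke_add hk0 _ _).symm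
  · obtain ⟨n, rfl⟩ := exists_eq_add_mul_of_two_mul (k := k) hodd (m := m) (m' := m')
      (by push_cast; exact h)
    exact (arc_up_add hk0 _ _).symm
  · exact absurd (by linear_combination h.2 - h.1) h2
  · exact absurd (by linear_combination h.1 - h.2) h2
  · obtain ⟨n, rfl⟩ := exists_eq_add_mul_of_two_mul (k := k) hodd (m := m) (m' := m')
      (by push_cast; exact h)
    exact (arc_down_add hk0 _ _).symm
  · rcases h with h | ⟨h, h'⟩
    · obtain ⟨n, rfl⟩ := exists_eq_add_mul h
      exact (arc_rim_add hk0 _ _).symm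
    · exact absurd (by linear_combination h' - h) h2

/-- The radius is strictly increasing except on the rim. There two parameters differ by at most 1,
less than the boundary period `k`. -/
theorem arc_injective (hk : 3 ≤ k) (l : Strand) : Function.Injective (l.arc k) := by
  intro t t' h
  obtain ⟨hr, hθ⟩ := eq_of_polarPoint_eq (by omega) (l.radius_mem t) (l.radius_mem t') h
  rcases l with m | m | m | p <;> simp only [radius, angle] at hr hθ
  · exact Subtype.ext (by linarith)
  · exact Subtype.ext (by linarith)
  · exact Subtype.ext (by linarith)
  · have hk' : (3 : ℝ) ≤ k := by exact_mod_cast hk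
    have key : ∀ n : ℤ, (t' : ℝ) = t + k * n → t = t' := by
      intro n hn
      have h1 : |(k : ℝ) * n| ≤ 1 := by
        rw [abs_le]
        constructor <;> linarith [t.2.1, t.2.2, t'.2.1, t'.2.2]
      have h2 : |(n : ℝ)| < 1 := by
        rw [abs_mul, abs_of_nonneg (by linarith)] at h1
        nlinarith [abs_nonneg (n : ℝ)]
      rw [← Int.cast_abs] at h2
      obtain rfl := Int.abs_lt_one_iff.1 (by exact_mod_cast h2)
      exact Subtype.ext (by simpa using hn.symm)
    rcases hθ with hθ | ⟨n, hn⟩ | ⟨-, n, hn⟩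
    · exfalso; linarith
    · exact key (2 * n) (by push_cast; linarith)
    · exact key n (by linarith)

end

end Strand

namespace Strand

/-- The point of the projective plane that represents a vertex. -/
noncomputable def vertexPoint (k : ℕ) : ZMod k ⊕ Option (ZMod k) → RealProjectivePlane
  | .inl a => polarPoint k 1 a.val
  | .inr (some a) => polarPoint k (1 / 2) (2 * ((k + 1) / 2 * a.val : ℕ))
  | .inr none => polarPoint k 0 0

variable {k : ℕ}

theorem vertexPoint_rimVertex (hk : 0 < k) (p : ℤ) :
    vertexPoint k (rimVertex k p) = polarPoint k 1 p := by
  have : NeZero k := ⟨hk.ne'⟩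
  have h : (((p : ZMod k).val : ℕ) : ℝ) = ((p % k : ℤ) : ℝ) := by
    rw [← ZMod.val_intCast, Int.cast_natCast]
  simp only [vertexPoint, rimVertex, h]
  rw [← polarPoint_one_add hk _ (p / k)]
  congr 1
  exact_mod_cast Int.emod_add_mul_ediv p k

/-- `(k + 1) / 2` inverts 2 modulo the odd `k`; hence the even angle chosen in `vertexPoint` differs
from `2 * m` by a multiple of the full turn `2 * k`. -/
theorem vertexPoint_copyVertex (hk : 0 < k) (hodd : Odd k) (m : ℤ) :
    vertexPoint k (copyVertex k (2 * m)) = polarPoint k (1 / 2) (2 * m) := by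
  have : NeZero k := ⟨hk.ne'⟩
  have h : ((((2 * m : ℤ) : ZMod k).val : ℕ) : ℤ) = 2 * m - k * (2 * m / k) := by
    rw [ZMod.val_intCast]
    linarith [Int.emod_add_mul_ediv (2 * m) k]
  obtain ⟨q, hq⟩ := hodd
  have hq' : (k + 1) / 2 = q + 1 := by omega
  simp only [vertexPoint, copyVertex]
  generalize ((2 * m : ℤ) : ZMod k).val = v at h
  rw [← polarPoint_add hk _ (2 * m) (m - (q + 1) * (2 * m / k)), hq']
  congr 1
  have h2 : (2 * ((q + 1) * v : ℕ) : ℤ) = 2 * m + 2 * k * (m - (q + 1) * (2 * m / k)) := by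
    push_cast
    rw [h, hq]
    push_cast
    ring
  exact_mod_cast h2

/-- As 2 is invertible modulo `k`, each copy has an even position, and the geometry can be done with
integer positions. -/
theorem exists_position (hodd : Odd k) (v : ZMod k ⊕ Option (ZMod k)) :
    (∃ p, v = rimVertex k p) ∨ (∃ m, v = copyVertex k (2 * m)) ∨ v = .inr none := by
  rcases v with a | _ | a
  · obtain ⟨p, rfl⟩ := ZMod.intCast_surjective a
    exact Or.inl ⟨p, rfl⟩
  · exact Or.inr (Or.inr rfl)
  · obtain ⟨m, rfl⟩ := exists_eq_two_mul hodd a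
    exact Or.inr (Or.inl ⟨m, rfl⟩)

theorem half_mem_Icc : (1 / 2 : ℝ) ∈ Set.Icc (0 : ℝ) 1 := by norm_num

theorem vertexPoint_injective (hk : 0 < k) (hodd : Odd k) :
    Function.Injective (vertexPoint k) := by
  have h0 : vertexPoint k (.inr none) = polarPoint k 0 0 := rfl
  have one : (1 : ℝ) ∈ Set.Icc (0 : ℝ) 1 := by norm_num
  have zero : (0 : ℝ) ∈ Set.Icc (0 : ℝ) 1 := by norm_num
  intro v v' h
  rcases exists_position hodd v with ⟨p, rfl⟩ | ⟨m, rfl⟩ | rfl <;>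
    rcases exists_position hodd v' with ⟨p', rfl⟩ | ⟨m', rfl⟩ | rfl <;>
    simp only [h0, vertexPoint_rimVertex hk, vertexPoint_copyVertex hk hodd] at h
  · obtain ⟨-, h | ⟨n, hn⟩ | ⟨-, n, hn⟩⟩ := eq_of_polarPoint_eq hk one one h
    · norm_num at h
    · have : p' = p + k * (2 * n) := by
        have : (p' : ℝ) = p + k * (2 * n) := by linarith
        exact_mod_cast this
      rw [this, rimVertex, rimVertex, intCast_add_mul_eq]
    · have : p' = p + k * n := by exact_mod_cast hn
      rw [this, rimVertex, rimVertex, intCast_add_mul_eq]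
  · exact absurd (eq_of_polarPoint_eq hk one half_mem_Icc h).1 (by norm_num)
  · exact absurd (eq_of_polarPoint_eq hk one zero h).1 (by norm_num)
  · exact absurd (eq_of_polarPoint_eq hk half_mem_Icc one h).1 (by norm_num)
  · obtain ⟨-, h | ⟨n, hn⟩ | ⟨h, -⟩⟩ := eq_of_polarPoint_eq hk half_mem_Icc half_mem_Icc h
    · norm_num at h
    · have : 2 * m' = 2 * m + k * (2 * n) := by
        have : 2 * (m' : ℝ) = 2 * m + k * (2 * n) := by linarith
        exact_mod_cast this
      rw [this, copyVertex, copyVertex, intCast_add_mul_eq]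
    · norm_num at h
  · exact absurd (eq_of_polarPoint_eq hk half_mem_Icc zero h).1 (by norm_num)
  · exact absurd (eq_of_polarPoint_eq hk zero one h).1 (by norm_num)
  · exact absurd (eq_of_polarPoint_eq hk zero half_mem_Icc h).1 (by norm_num)
  · rfl

theorem arc_ends (hk : 0 < k) (hodd : Odd k) (l : Strand) :
    s(l.arc k 0, l.arc k 1) = (l.edge k).map (vertexPoint k) := by
  have h0 : vertexPoint k (.inr none) = polarPoint k 0 0 := rfl
  cases l with
  | spoke m =>
    simp only [arc, radius, angle, edge, ContinuousMap.coe_mk, Sym2.map_mk, h0,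
      vertexPoint_copyVertex hk hodd, Set.Icc.coe_zero, Set.Icc.coe_one, zero_div]
    rw [polarPoint_zero _ 0]
  | up m =>
    simp [arc, radius, angle, edge, vertexPoint_copyVertex hk hodd, vertexPoint_rimVertex hk]
  | down m =>
    simp [arc, radius, angle, edge, vertexPoint_copyVertex hk hodd, vertexPoint_rimVertex hk]
  | rim p => simp [arc, radius, angle, edge, vertexPoint_rimVertex hk]

theorem arc_ne_vertexPoint (hk : 0 < k) (hodd : Odd k) (l : Strand) {t : I}
    (ht : t ∈ Set.Ioo 0 1) (v : ZMod k ⊕ Option (ZMod k)) : l.arc k t ≠ vertexPoint k v := by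
  have h0 : vertexPoint k (.inr none) = polarPoint k 0 0 := rfl
  have one : (1 : ℝ) ∈ Set.Icc (0 : ℝ) 1 := by norm_num
  have zero : (0 : ℝ) ∈ Set.Icc (0 : ℝ) 1 := by norm_num
  have ht0 : 0 < (t : ℝ) := ht.1
  have ht1 : (t : ℝ) < 1 := ht.2
  intro h
  rcases exists_position hodd v with ⟨p, rfl⟩ | ⟨m, rfl⟩ | rfl <;>
    simp only [h0, vertexPoint_rimVertex hk, vertexPoint_copyVertex hk hodd] at h
  · obtain ⟨hr, hθ⟩ := eq_of_polarPoint_eq hk (l.radius_mem t) one h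
    have key : ∀ z : ℤ, (t : ℝ) ≠ z := by
      intro z hz
      rw [hz] at ht0 ht1
      have h0 : 0 < z := by exact_mod_cast ht0
      have h1 : z < 1 := by exact_mod_cast ht1
      omega
    rcases l with m | m | m | p' <;> simp only [radius, angle] at hr hθ <;> try linarith
    rcases hθ with hθ | ⟨n, hn⟩ | ⟨-, n, hn⟩
    · norm_num at hθ
    · exact key (p - p' - 2 * k * n) (by push_cast; linarith)
    · exact key (p - p' - k * n) (by push_cast; linarith)
  · obtain ⟨hr, -⟩ := eq_of_polarPoint_eq hk (l.radius_mem t) half_mem_Icc h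
    cases l <;> simp only [radius] at hr <;> linarith
  · obtain ⟨hr, -⟩ := eq_of_polarPoint_eq hk (l.radius_mem t) zero h
    cases l <;> simp only [radius] at hr <;> linarith

/-- Together with `Quad.not_isSkeletal` this shows that the open cells miss the drawing. -/
theorem isSkeletal_of_mem {r θ : ℝ} (hk : 0 < k) (hodd : Odd k) (hr : r ∈ Set.Icc (0 : ℝ) 1)
    (h : polarPoint k r θ ∈ Set.range (vertexPoint k) ∪ ⋃ l : Strand, Set.range (l.arc k)) :
    IsSkeletal r θ := by
  rcases h with ⟨v, hv⟩ | h
  · rcases exists_position hodd v with ⟨p, rfl⟩ | ⟨m, rfl⟩ | rfl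
    · rw [vertexPoint_rimVertex hk] at hv
      exact IsSkeletal.of_polarPoint_eq hk (by norm_num) hr hv (Or.inr (Or.inl rfl))
    · rw [vertexPoint_copyVertex hk hodd] at hv
      exact IsSkeletal.of_polarPoint_eq hk half_mem_Icc hr hv
        (Or.inr (Or.inr (Or.inr ⟨le_rfl, m, rfl⟩)))
    · exact IsSkeletal.of_polarPoint_eq hk (by norm_num) hr hv (Or.inl rfl)
  · obtain ⟨l, t, ht⟩ := Set.mem_iUnion.1 h
    exact IsSkeletal.of_polarPoint_eq hk (l.radius_mem t) hr ht (l.isSkeletal t)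

end Strand

/-! ### The cells: parametrization, disjointness and covering. -/

/-- The quadrangular cells into which the drawing divides the projective plane: the cells around the
apex, and the cells along the cycle. -/
inductive Quad
  | inner (m : ℤ)
  | outer (m : ℤ)

namespace Quad

/-- The radius of a point of a cell. -/
noncomputable def radius : Quad → ℝ → ℝ → ℝ
  | inner _, s, t => (s + t) / 2
  | outer _, s, t => (1 + max s t) / 2

/-- The angle of a point of a cell. -/
noncomputable def angle : Quad → ℝ → ℝ → ℝ
  | inner m, s, t => 2 * m + 1 - (s - t) / max s t
  | outer m, s, t => 2 * m + (s - t)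

theorem radius_mem (c : Quad) (s t : I) : c.radius s t ∈ Set.Icc (0 : ℝ) 1 := by
  have := s.2.1
  have := s.2.2
  have := t.2.1
  have := t.2.2
  have := le_max_left (s : ℝ) t
  have : max (s : ℝ) t ≤ 1 := max_le s.2.2 t.2.2
  cases c <;> simp only [radius] <;> constructor <;> linarith

/-- The parametrization of a cell by the unit square. -/
noncomputable def map (k : ℕ) (c : Quad) : C(I × I, RealProjectivePlane) where
  toFun z := polarPoint k (c.radius z.1 z.2) (c.angle z.1 z.2)
  continuous_toFun := by
    cases c with
    | inner m =>
      simp only [radius, angle]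
      refine continuous_polarPoint (by fun_prop) fun z hz => ?_
      -- The denominator vanishes only at the corner `(0, 0)`, which is the apex, where no
      -- continuity of the angle is required.
      have : max (z.1 : ℝ) z.2 ≠ 0 := by
        intro h
        have h1 := le_max_left (z.1 : ℝ) z.2
        have h2 := le_max_right (z.1 : ℝ) z.2
        have h3 := z.1.2.1
        have h4 := z.2.2.1
        exact hz (by linarith)
      refine ContinuousAt.sub continuousAt_const (ContinuousAt.div ?_ ?_ this) <;>
        exact Continuous.continuousAt (by fun_prop)
    | outer m =>
      simp only [radius, angle]
      exact continuous_polarPoint (by fun_prop) fun z _ => Continuous.continuousAt (by fun_prop)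

theorem map_apply (k : ℕ) (c : Quad) (s t : I) :
    c.map k (s, t) = polarPoint k (c.radius s t) (c.angle s t) := rfl

/-- Normal form of the coordinates of an inner cell. -/
theorem exists_inner_coordinates {s t : ℝ} (hs : 0 ≤ s) (ht : 0 ≤ t) (h : 0 < max s t) :
    ∃ u, (s - t) / max s t = u ∧ |u| ≤ 1 ∧ s - t = u * max s t ∧
      (s + t) / 2 = max s t * (1 - |u| / 2) := by
  refine ⟨_, rfl, ?_, (div_mul_cancel₀ _ h.ne').symm, ?_⟩
  · rw [abs_div, abs_of_pos h, div_le_one h, abs_le]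
    constructor <;> linarith [le_max_left s t, le_max_right s t]
  · rw [abs_div, abs_of_pos h]
    field_simp
    rcases le_total s t with h1 | h1
    · rw [max_eq_right h1, abs_of_nonpos (by linarith)]
      ring
    · rw [max_eq_left h1, abs_of_nonneg (by linarith)]
      ring

theorem angle_outer_abs (s t : I) : |(s : ℝ) - t| ≤ max (s : ℝ) t := by
  rw [abs_le]
  constructor <;> linarith [le_max_left (s : ℝ) t, le_max_right (s : ℝ) t, s.2.1, t.2.1]

variable {k : ℕ}

/-- In an inner cell the angle gives `u = (s - t) / max s t`, then the radius `max s t * (1 - |u| /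
2)` gives the maximum. In an outer cell radius and angle give `max s t` and `s - t` directly. -/
theorem map_injective (hk : 3 ≤ k) (c : Quad) : Function.Injective (c.map k) := by
  rintro ⟨s, t⟩ ⟨s', t'⟩ h
  obtain ⟨hr, hθ⟩ := eq_of_polarPoint_eq (by omega) (c.radius_mem s t) (c.radius_mem s' t') h
  have hk' : (3 : ℝ) ≤ k := by exact_mod_cast hk
  -- A cell spans an angle of at most 2, and `k ≥ 3`, so it cannot meet itself after a half or full
  -- turn.
  have key : ∀ n : ℤ, |(k : ℝ) * n| ≤ 2 → n = 0 := by
    intro n hn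
    rw [abs_mul, abs_of_nonneg (by linarith)] at hn
    have h2 : |(n : ℝ)| < 1 := by nlinarith [abs_nonneg (n : ℝ)]
    rw [← Int.cast_abs] at h2
    exact Int.abs_lt_one_iff.1 (by exact_mod_cast h2)
  have hs0 := s.2.1
  have ht0 := t.2.1
  have hs0' := s'.2.1
  have ht0' := t'.2.1
  have hs1 := s.2.2
  have ht1 := t.2.2
  have hs1' := s'.2.2
  have ht1' := t'.2.2
  suffices (s : ℝ) = s' ∧ (t : ℝ) = t' from Prod.ext (Subtype.ext this.1) (Subtype.ext this.2)
  cases c with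
  | inner m =>
    simp only [radius, angle] at hr hθ
    rcases hθ with h0 | ⟨n, hn⟩ | ⟨h1, -⟩
    · constructor <;> linarith
    · by_cases h0 : (s : ℝ) + t = 0
      · constructor <;> linarith
      have hpos : ∀ {a b : ℝ}, 0 ≤ a → 0 ≤ b → a + b ≠ 0 → 0 < max a b := by
        intro a b ha hb hab
        rcases ha.eq_or_lt with rfl | ha
        · exact lt_max_of_lt_right (lt_of_le_of_ne hb (by simpa using hab.symm))
        · exact lt_max_of_lt_left ha
      obtain ⟨u, hu, hu1, hd, hm⟩ := exists_inner_coordinates hs0 ht0 (hpos hs0 ht0 h0)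
      obtain ⟨u', hu', hu1', hd', hm'⟩ := exists_inner_coordinates hs0' ht0'
        (hpos hs0' ht0' (fun h => h0 (by linarith)))
      rw [hu, hu'] at hn
      have hb := abs_le.1 hu1
      have hb' := abs_le.1 hu1'
      obtain rfl : n = 0 := by
        have := key (2 * n) (by rw [abs_le]; push_cast; constructor <;> linarith)
        omega
      obtain rfl : u' = u := by
        push_cast at hn
        linarith
      have hmax : max (s : ℝ) t = max (s' : ℝ) t' := by
        rw [hm, hm'] at hr
        exact (mul_right_cancel₀ (by linarith) hr).symm
      rw [hmax] at hd
      constructor <;> linarith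
    · constructor <;> linarith
  | outer m =>
    simp only [radius, angle] at hr hθ
    have hmax : max (s' : ℝ) t' = max (s : ℝ) t := by linarith
    have hle : max (s : ℝ) t ≤ 1 := max_le hs1 ht1
    have hb := abs_le.1 ((angle_outer_abs s t).trans hle)
    have hb' := abs_le.1 ((angle_outer_abs s' t').trans (hmax.le.trans hle))
    have hsub : (s' : ℝ) - t' = s - t := by
      rcases hθ with h0 | ⟨n, hn⟩ | ⟨-, n, hn⟩
      · linarith [le_max_left (s : ℝ) t]
      · have := key (2 * n) (by rw [abs_le]; push_cast; constructor <;> linarith)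
        obtain rfl : n = 0 := by omega
        push_cast at hn
        linarith
      · obtain rfl := key n (by rw [abs_le]; constructor <;> linarith)
        push_cast at hn
        linarith
    rcases le_total (s : ℝ) t with h1 | h1
    · rw [max_eq_right h1, max_eq_right (by linarith : (s' : ℝ) ≤ t')] at hmax
      constructor <;> linarith
    · rw [max_eq_left h1, max_eq_left (by linarith : (t' : ℝ) ≤ s')] at hmax
      constructor <;> linarith

/-- The corner `(0, 0)` is the apex and `(1, 1)` the cycle vertex at angle `2 * m + 1`; the other
two corners are the copies at `2 * m` and `2 * m + 2`. -/
theorem image_compl_inner (m : ℤ) :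
    (inner m).map k '' (Set.Ioo (0 : I) 1 ×ˢ Set.Ioo (0 : I) 1)ᶜ =
      Set.range ((Strand.spoke m).arc k) ∪ Set.range ((Strand.spoke (m + 1)).arc k) ∪
        Set.range ((Strand.up m).arc k) ∪ Set.range ((Strand.down (m + 1)).arc k) := by
  rw [image_compl_openSquare]
  congr 1; congr 1; congr 1
  · congr 1
    ext t
    by_cases h : (t : ℝ) = 0
    · simp only [map_apply, radius, Strand.arc, Strand.radius, ContinuousMap.coe_mk, h,
        Set.Icc.coe_zero, add_zero, zero_div]
      exact polarPoint_zero _ _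
    · simp [map_apply, radius, angle, Strand.arc, Strand.radius, Strand.angle, max_eq_left t.2.1, h]
  · congr 1
    ext t
    by_cases h : (t : ℝ) = 0
    · simp only [map_apply, radius, Strand.arc, Strand.radius, ContinuousMap.coe_mk, h,
        Set.Icc.coe_zero, add_zero, zero_div]
      exact polarPoint_zero _ _
    · simp only [map_apply, radius, angle, Strand.arc, Strand.radius, Strand.angle,
        ContinuousMap.coe_mk, Set.Icc.coe_zero, max_eq_right t.2.1, zero_sub, zero_add, neg_div,
        div_self h]
      congr 1
      push_cast
      ring
  · congr 1
    ext t
    simp only [map_apply, radius, angle, Strand.arc, Strand.radius, Strand.angle,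
        ContinuousMap.coe_mk, Set.Icc.coe_one, max_eq_left t.2.2, div_one]
    congr 1
    ring
  · congr 1
    ext t
    simp only [map_apply, radius, angle, Strand.arc, Strand.radius, Strand.angle,
        ContinuousMap.coe_mk, Set.Icc.coe_one, max_eq_right t.2.2, div_one]
    congr 1
    · ring
    · push_cast
      ring

/-- The corner `(0, 0)` is the copy at angle `2 * m`, and `(1, 1)` the cycle vertex at the same
angle. The side `s = 1` runs against the direction of its rim arc, hence the reversal. -/
theorem image_compl_outer (m : ℤ) :
    (outer m).map k '' (Set.Ioo (0 : I) 1 ×ˢ Set.Ioo (0 : I) 1)ᶜ =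
      Set.range ((Strand.up m).arc k) ∪ Set.range ((Strand.down m).arc k) ∪
        Set.range ((Strand.rim (2 * m)).arc k) ∪ Set.range ((Strand.rim (2 * m - 1)).arc k) := by
  rw [image_compl_openSquare]
  congr 1; congr 1; congr 1
  · congr 1
    ext t
    simp [map_apply, radius, angle, Strand.arc, Strand.radius, Strand.angle, max_eq_left t.2.1]
  · congr 1
    ext t
    simp only [map_apply, radius, angle, Strand.arc, Strand.radius, Strand.angle,
        ContinuousMap.coe_mk, Set.Icc.coe_zero, max_eq_right t.2.1]
    congr 1
    ring
  · rw [← range_comp_symm ((Strand.rim (2 * m)).arc k)]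
    congr 1
    ext t
    simp only [map_apply, radius, angle, Strand.arc, Strand.radius, Strand.angle,
        ContinuousMap.coe_mk, Set.Icc.coe_one, max_eq_left t.2.2, unitInterval.coe_symm_eq]
    congr 1
    · norm_num
    · push_cast
      ring
  · congr 1
    ext t
    simp only [map_apply, radius, angle, Strand.arc, Strand.radius, Strand.angle,
        ContinuousMap.coe_mk, Set.Icc.coe_one, max_eq_right t.2.2]
    congr 1
    · norm_num
    · push_cast
      ring

end Quad

namespace Quad

variable {k : ℕ}

/-- The bound `1 - |u| / 2` is the height of the wave at this angle: the open inner cells lie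
strictly below the zigzag. -/
theorem inner_mem_openSquare {s t : I} (hs : s ∈ Set.Ioo (0 : I) 1) (ht : t ∈ Set.Ioo (0 : I) 1)
    (m : ℤ) : ∃ u, |u| < 1 ∧ (inner m).angle s t = 2 * m + 1 - u ∧
      0 < (inner m).radius s t ∧ (inner m).radius s t < 1 - |u| / 2 := by
  have hs0 : (0 : ℝ) < s := hs.1
  have ht0 : (0 : ℝ) < t := ht.1
  have hmax : 0 < max (s : ℝ) t := lt_max_of_lt_left hs0
  have hmax1 : max (s : ℝ) t < 1 := max_lt hs.2 ht.2
  obtain ⟨u, hu, hu1, hd, hm⟩ := exists_inner_coordinates hs0.le ht0.le hmax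
  refine ⟨u, ?_, by rw [← hu]; rfl, by simp only [radius]; linarith, ?_⟩
  · rw [← hu, abs_div, abs_of_pos hmax, div_lt_one hmax, abs_lt]
    constructor <;> linarith [le_max_left (s : ℝ) t, le_max_right (s : ℝ) t]
  · simp only [radius]
    rw [hm]
    nlinarith

theorem triangleWave_outer (s t : I) (m : ℤ) :
    triangleWave ((outer m).angle s t) = (1 + |(s : ℝ) - t|) / 2 :=
  triangleWave_even_add _ ((angle_outer_abs s t).trans (max_le s.2.2 t.2.2))

theorem outer_mem_openSquare {s t : I} (hs : s ∈ Set.Ioo (0 : I) 1) (ht : t ∈ Set.Ioo (0 : I) 1)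
    (m : ℤ) : |(s : ℝ) - t| < 1 ∧ triangleWave ((outer m).angle s t) < (outer m).radius s t ∧
      (outer m).radius s t < 1 := by
  have hs0 : (0 : ℝ) < s := hs.1
  have ht0 : (0 : ℝ) < t := ht.1
  have hmax1 : max (s : ℝ) t < 1 := max_lt hs.2 ht.2
  have h : |(s : ℝ) - t| < max (s : ℝ) t := by
    rw [abs_lt]
    constructor <;> linarith [le_max_left (s : ℝ) t, le_max_right (s : ℝ) t]
  refine ⟨by linarith, ?_, by simp only [radius]; linarith⟩
  rw [triangleWave_outer]
  simp only [radius]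
  linarith

theorem not_isSkeletal (c : Quad) {s t : I} (hs : s ∈ Set.Ioo (0 : I) 1)
    (ht : t ∈ Set.Ioo (0 : I) 1) : ¬ IsSkeletal (c.radius s t) (c.angle s t) := by
  cases c with
  | inner m =>
    obtain ⟨u, hu, hθ, hr0, hr1⟩ := inner_mem_openSquare hs ht m
    rw [hθ]
    rintro (h | h | h | ⟨-, m', h⟩)
    · linarith
    · linarith [abs_nonneg u]
    · rw [triangleWave_odd_sub _ hu.le] at h
      linarith
    · have hz : u = ((2 * (m - m') + 1 : ℤ) : ℝ) := by push_cast; linarith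
      rw [hz, ← Int.cast_abs] at hu
      have := Int.abs_lt_one_iff.1 (by exact_mod_cast hu)
      omega
  | outer m =>
    obtain ⟨-, h1, h2⟩ := outer_mem_openSquare hs ht m
    have := (triangleWave_mem ((outer m).angle s t)).1
    rintro (h | h | h | ⟨h, -⟩) <;> linarith

theorem exists_shift {θ θ' : ℝ} {m m' : ℤ} {a b : ℝ} (ha : |a| < 1) (hb : |b| < 1) {n : ℤ}
    (hθ : θ = 2 * m + a) (hθ' : θ' = 2 * m' + b) (h : θ' = θ + 2 * k * n) : m' = m + k * n := by
  rw [abs_lt] at ha hb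
  have hz : (a - b) / 2 = ((m' - (m + k * n) : ℤ) : ℝ) := by push_cast; linarith
  have hlt : |(a - b) / 2| < 1 := by
    rw [abs_lt]
    constructor <;> linarith
  rw [hz, ← Int.cast_abs] at hlt
  have := Int.abs_lt_one_iff.1 (by exact_mod_cast hlt)
  linarith

/-- Interior points are not skeletal, so they are neither the centre nor on the boundary, and their
angles agree up to full turns. The side of the wave then tells inner from outer, and offsets below 1
fix the label modulo `k`. -/
theorem eq_of_map_eq (hk : 0 < k) {c c' : Quad} {s t s' t' : I} (hs : s ∈ Set.Ioo (0 : I) 1)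
    (ht : t ∈ Set.Ioo (0 : I) 1) (hs' : s' ∈ Set.Ioo (0 : I) 1) (ht' : t' ∈ Set.Ioo (0 : I) 1)
    (h : c.map k (s, t) = c'.map k (s', t')) :
    (∃ m n : ℤ, c = inner m ∧ c' = inner (m + k * n)) ∨
      (∃ m n : ℤ, c = outer m ∧ c' = outer (m + k * n)) := by
  obtain ⟨hr, hθ⟩ := eq_of_polarPoint_eq hk (c.radius_mem s t) (c'.radius_mem s' t') h
  have hns := c.not_isSkeletal hs ht
  have hθ : ∃ n : ℤ, c'.angle s' t' = c.angle s t + 2 * k * n := by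
    rcases hθ with h0 | h0 | ⟨h1, -⟩
    · exact absurd (Or.inl h0) hns
    · exact h0
    · exact absurd (Or.inr (Or.inl h1)) hns
  obtain ⟨n, hn⟩ := hθ
  have hwave : triangleWave (c'.angle s' t') = triangleWave (c.angle s t) := by
    rw [hn, ← triangleWave_add (c.angle s t) (k * n)]
    congr 1
    push_cast
    ring
  rcases c with m | m <;> rcases c' with m' | m'
  · obtain ⟨u, hu, hc, -⟩ := inner_mem_openSquare hs ht m
    obtain ⟨u', hu', hc', -⟩ := inner_mem_openSquare hs' ht' m'
    exact Or.inl ⟨m, n, rfl, congrArg _ (exists_shift (a := -u) (b := -u') (θ := 2 * m - u)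
      (θ' := 2 * m' - u') (by rwa [abs_neg]) (by rwa [abs_neg]) (by ring) (by ring) (by linarith))⟩
  · obtain ⟨u, hu, hc, -, hlt⟩ := inner_mem_openSquare hs ht m
    obtain ⟨-, hgt, -⟩ := outer_mem_openSquare hs' ht' m'
    rw [hwave, hc, triangleWave_odd_sub _ hu.le] at hgt
    linarith
  · obtain ⟨u, hu, hc, -, hlt⟩ := inner_mem_openSquare hs' ht' m'
    obtain ⟨-, hgt, -⟩ := outer_mem_openSquare hs ht m
    rw [← hwave, hc, triangleWave_odd_sub _ hu.le] at hgt
    linarith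
  · obtain ⟨hu, -⟩ := outer_mem_openSquare hs ht m
    obtain ⟨hu', -⟩ := outer_mem_openSquare hs' ht' m'
    exact Or.inr ⟨m, n, rfl, congrArg _ (exists_shift hu hu' rfl rfl hn)⟩

/-- The `k` inner and the `k` outer cells. -/
def ofIndex (k : ℕ) : Fin k ⊕ Fin k → Quad :=
  Sum.elim (fun i => inner i.val) (fun i => outer i.val)

theorem ofIndex_disjoint (hk : 0 < k) {i j : Fin k ⊕ Fin k} (hij : i ≠ j) :
    Disjoint ((ofIndex k i).map k '' (Set.Ioo (0 : I) 1 ×ˢ Set.Ioo (0 : I) 1))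
      ((ofIndex k j).map k '' (Set.Ioo (0 : I) 1 ×ˢ Set.Ioo (0 : I) 1)) := by
  rw [Set.disjoint_left]
  rintro _ ⟨⟨s, t⟩, ⟨hs, ht⟩, rfl⟩ ⟨⟨s', t'⟩, ⟨hs', ht'⟩, h⟩
  have key : ∀ (a b : Fin k) (n : ℤ), (b.val : ℤ) = a.val + k * n → a = b := by
    intro a b n h
    have ha := a.2
    have hb := b.2
    have h1 : (a.val : ℤ) % k = b.val % k := by rw [h, Int.add_mul_emod_self_left]
    rw [Int.emod_eq_of_lt (by omega) (by omega), Int.emod_eq_of_lt (by omega) (by omega)] at h1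
    exact Fin.ext (by exact_mod_cast h1)
  apply hij
  rcases eq_of_map_eq hk hs ht hs' ht' h.symm with ⟨m, n, h1, h2⟩ | ⟨m, n, h1, h2⟩ <;>
    rcases i with i | i <;> rcases j with j | j <;> simp [ofIndex] at h1 h2
  · exact congrArg _ (key i j n (by rw [h1, h2]))
  · exact congrArg _ (key i j n (by rw [h1, h2]))

theorem exists_mem_map {r θ : ℝ} (hr : r ∈ Set.Icc (0 : ℝ) 1) : ∃ c : Quad, ∃ z : I × I,
    c.map k z = polarPoint k r θ := by
  rcases le_total r (triangleWave θ) with h | h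
  · obtain ⟨m, u, hu, rfl⟩ := exists_eq_odd_sub θ
    rw [triangleWave_odd_sub _ hu] at h
    rcases hr.1.eq_or_lt with rfl | hr0
    · refine ⟨inner m, (0, 0), ?_⟩
      simp only [map_apply, radius, Set.Icc.coe_zero, add_zero, zero_div]
      exact polarPoint_zero _ _
    have hpos : 0 < 1 - |u| / 2 := by linarith
    -- `M` is the future `max s t`; the smaller coordinate must then be `M * (1 - |u|)`.
    obtain ⟨M, hM0, hM1, hM⟩ : ∃ M, 0 < M ∧ M ≤ 1 ∧ r = M * (1 - |u| / 2) :=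
      ⟨r / (1 - |u| / 2), by positivity, (div_le_one hpos).2 h, (div_mul_cancel₀ _ hpos.ne').symm⟩
    rw [abs_le] at hu
    rcases le_total 0 u with h0 | h0
    · rw [abs_of_nonneg h0] at hM
      refine ⟨inner m, (⟨M, hM0.le, hM1⟩, ⟨M * (1 - u), ?_, ?_⟩), ?_⟩
      · exact mul_nonneg hM0.le (by linarith)
      · nlinarith
      have hmax : max M (M * (1 - u)) = M := max_eq_left (by nlinarith)
      simp only [map_apply, radius, angle, hmax]
      congr 1
      · rw [hM]; ring
      · field_simp
        ring
    · rw [abs_of_nonpos h0] at hM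
      refine ⟨inner m, (⟨M * (1 + u), ?_, ?_⟩, ⟨M, hM0.le, hM1⟩), ?_⟩
      · exact mul_nonneg hM0.le (by linarith)
      · nlinarith
      have hmax : max (M * (1 + u)) M = M := max_eq_right (by nlinarith)
      simp only [map_apply, radius, angle, hmax]
      congr 1
      · rw [hM]; ring
      · field_simp
        ring
  · obtain ⟨m, τ, hτ, rfl⟩ := exists_eq_even_add θ
    rw [triangleWave_even_add _ hτ] at h
    have hr1 := hr.2
    rcases le_total 0 τ with h0 | h0
    · rw [abs_of_nonneg h0] at h
      -- The radius forces `max s t = 2 * r - 1`, the angle forces `s - t = τ`; lying above the wave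
      -- makes the smaller coordinate nonnegative.
      refine ⟨outer m, (⟨2 * r - 1, by linarith, by linarith⟩,
        ⟨2 * r - 1 - τ, by linarith, by linarith⟩), ?_⟩
      simp only [map_apply, radius, angle, max_eq_left (by linarith : 2 * r - 1 - τ ≤ 2 * r - 1)]
      congr 1 <;> ring
    · rw [abs_of_nonpos h0] at h
      refine ⟨outer m, (⟨2 * r - 1 + τ, by linarith, by linarith⟩,
        ⟨2 * r - 1, by linarith, by linarith⟩), ?_⟩
      simp only [map_apply, radius, angle, max_eq_right (by linarith : 2 * r - 1 + τ ≤ 2 * r - 1)]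
      congr 1 <;> ring

theorem exists_map_ofIndex (hk : 0 < k) (c : Quad) :
    ∃ i, ∀ z, (ofIndex k i).map k z = c.map k z := by
  have hmod : ∀ m : ℤ, ∃ i : Fin k, m = i.val + k * (m / k) := by
    intro m
    have h0 := Int.emod_nonneg m (by omega : (k : ℤ) ≠ 0)
    have h1 := Int.emod_lt_of_pos m (by omega : 0 < (k : ℤ))
    refine ⟨⟨(m % k).toNat, by omega⟩, ?_⟩
    rw [Int.toNat_of_nonneg h0, Int.emod_add_mul_ediv]
  rcases c with m | m
  · obtain ⟨i, hi⟩ := hmod m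
    generalize m / (k : ℤ) = n at hi
    subst hi
    refine ⟨.inl i, fun ⟨s, t⟩ => ?_⟩
    simp only [map_apply, radius, angle, ofIndex, Sum.elim_inl]
    rw [← polarPoint_add hk _ _ n]
    congr 1
    push_cast
    ring
  · obtain ⟨i, hi⟩ := hmod m
    generalize m / (k : ℤ) = n at hi
    subst hi
    refine ⟨.inr i, fun ⟨s, t⟩ => ?_⟩
    simp only [map_apply, radius, angle, ofIndex, Sum.elim_inr]
    rw [← polarPoint_add hk _ _ n]
    congr 1
    push_cast
    ring

end Quad

namespace Strand

variable {k : ℕ}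

theorem edge_mem_edgeSet (hk : 3 ≤ k) (l : Strand) :
    l.edge k ∈ (mycielskiGraph (SimpleGraph.circulantGraph ({1} : Set (ZMod k)))).edgeSet := by
  have : Fact (1 < k) := ⟨by omega⟩
  rcases l with m | m | m | p <;> rw [edge, SimpleGraph.mem_edgeSet]
  · trivial
  all_goals
    change (SimpleGraph.circulantGraph ({1} : Set (ZMod k))).Adj _ _
    simp [eq_sub_iff_add_eq]

theorem exists_edge_eq (hodd : Odd k) {e : Sym2 (ZMod k ⊕ Option (ZMod k))}
    (he : e ∈ (mycielskiGraph (SimpleGraph.circulantGraph ({1} : Set (ZMod k)))).edgeSet) :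
    ∃ l : Strand, l.edge k = e := by
  have key : ∀ a b : ZMod k, (SimpleGraph.circulantGraph ({1} : Set (ZMod k))).Adj a b →
      b = a + 1 ∨ b = a - 1 := by
    intro a b h
    rw [SimpleGraph.circulantGraph_adj] at h
    rcases h.2 with h | h
    · right
      rw [← Set.mem_singleton_iff.1 h]
      ring
    · left
      rw [← Set.mem_singleton_iff.1 h]
      ring
  have mixed : ∀ a b : ZMod k, (SimpleGraph.circulantGraph ({1} : Set (ZMod k))).Adj a b →
      ∃ l : Strand, l.edge k = s(.inr (some a), .inl b) := by
    intro a b h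
    obtain ⟨m, rfl⟩ := exists_eq_two_mul hodd a
    rcases key _ _ h with rfl | rfl
    · exact ⟨up m, by simp [edge, copyVertex, rimVertex]⟩
    · exact ⟨down m, by simp [edge, copyVertex, rimVertex]⟩
  have apex : ∀ a : ZMod k, ∃ l : Strand, l.edge k = s(.inr none, .inr (some a)) := by
    intro a
    obtain ⟨m, rfl⟩ := exists_eq_two_mul hodd a
    exact ⟨spoke m, rfl⟩
  induction e with
  | h u v =>
    rw [SimpleGraph.mem_edgeSet] at he
    rcases u with a | _ | a <;> rcases v with b | _ | b
    · obtain ⟨p, rfl⟩ := ZMod.intCast_surjective a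
      obtain ⟨p', rfl⟩ := ZMod.intCast_surjective b
      rcases key _ _ he with h | h
      · rw [h]
        exact ⟨rim p, by simp [edge, rimVertex]⟩
      · rw [eq_sub_iff_add_eq] at h
        rw [← h]
        exact ⟨rim p', by simp [edge, rimVertex]⟩
    · exact he.elim
    · obtain ⟨l, hl⟩ := mixed b a (SimpleGraph.Adj.symm he)
      exact ⟨l, hl.trans Sym2.eq_swap⟩
    · exact he.elim
    · exact he.elim
    · exact apex b
    · exact mixed a b he
    · obtain ⟨l, hl⟩ := apex a
      exact ⟨l, hl.trans Sym2.eq_swap⟩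
    · exact he.elim

end Strand

theorem SimpleGraph.exists_isCycle_of_length_four {V : Type*} {G : SimpleGraph V} {a b c d : V}
    (hab : G.Adj a b) (hbc : G.Adj b c) (hcd : G.Adj c d) (hda : G.Adj d a) (hac : a ≠ c)
    (hbd : b ≠ d) : ∃ p : G.Walk a a, p.IsCycle ∧ p.length = 4 ∧
      p.edges = [s(a, b), s(b, c), s(c, d), s(d, a)] := by
  refine ⟨.cons hab (.cons hbc (.cons hcd (.cons hda .nil))), ?_, rfl, rfl⟩
  have := hab.ne
  have := hbc.ne
  have := hcd.ne
  have := hda.ne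
  rw [SimpleGraph.Walk.cons_isCycle_iff]
  simp_all [SimpleGraph.Walk.isPath_def, eq_comm]

/-! ### Assembling the drawing and identifying its faces. -/

namespace Strand

variable {k : ℕ}

/-- The labels of the edges in the drawing. -/
noncomputable def ofEdge (hodd : Odd k)
    (e : (mycielskiGraph (SimpleGraph.circulantGraph ({1} : Set (ZMod k)))).edgeSet) : Strand :=
  (exists_edge_eq hodd e.2).choose

theorem edge_ofEdge (hodd : Odd k)
    (e : (mycielskiGraph (SimpleGraph.circulantGraph ({1} : Set (ZMod k)))).edgeSet) :
    (ofEdge hodd e).edge k = e :=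
  (exists_edge_eq hodd e.2).choose_spec

/-- The drawing of the Mycielski graph of an odd cycle in the projective plane. -/
noncomputable def drawing (hk : 3 ≤ k) (hodd : Odd k) :
    GraphDrawing (mycielskiGraph (SimpleGraph.circulantGraph ({1} : Set (ZMod k))))
      RealProjectivePlane where
  point := vertexPoint k
  point_injective := vertexPoint_injective (by omega) hodd
  arc e := (ofEdge hodd e).arc k
  arc_isEmbedding e :=
    ((ContinuousMap.continuous _).isClosedEmbedding (arc_injective hk _)).isEmbedding
  arc_ends e := by rw [arc_ends (by omega) hodd, edge_ofEdge]
  arc_avoids e := by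
    rw [Set.disjoint_left]
    rintro _ ⟨t, ht, rfl⟩ ⟨v, hv⟩
    exact arc_ne_vertexPoint (by omega) hodd _ ht v hv.symm
  arc_disjoint e f hef := by
    rw [Set.disjoint_left]
    rintro _ ⟨t, ht, rfl⟩ ⟨t', ht', h⟩
    refine hef (Subtype.ext ?_)
    rw [← edge_ofEdge hodd e, ← edge_ofEdge hodd f]
    exact (edge_eq_of_mem_Ioo hk ht' ht h).symm

theorem drawing_arc (hk : 3 ≤ k) (hodd : Odd k) (l : Strand) :
    (drawing hk hodd).arc ⟨l.edge k, edge_mem_edgeSet hk l⟩ = l.arc k :=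
  arc_congr hk hodd (edge_ofEdge hodd _)

theorem drawing_carrier (hk : 3 ≤ k) (hodd : Odd k) : (drawing hk hodd).carrier =
    Set.range (vertexPoint k) ∪ ⋃ l : Strand, Set.range (l.arc k) := by
  refine congrArg (Set.range (vertexPoint k) ∪ ·) (Set.Subset.antisymm ?_ ?_)
  · exact Set.iUnion_subset fun e => Set.subset_iUnion (fun l : Strand => Set.range (l.arc k))
      (ofEdge hodd e)
  · refine Set.iUnion_subset fun l => ?_
    rw [← drawing_arc hk hodd l]
    exact Set.subset_iUnion (fun e => Set.range ((drawing hk hodd).arc e)) _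

theorem iUnion_drawing_arc (hk : 3 ≤ k) (hodd : Odd k) {v : ZMod k ⊕ Option (ZMod k)}
    (p : (mycielskiGraph (SimpleGraph.circulantGraph ({1} : Set (ZMod k)))).Walk v v)
    {a b c d : Strand} (hp : p.edges = [a.edge k, b.edge k, c.edge k, d.edge k]) :
    (⋃ e ∈ {e : (mycielskiGraph (SimpleGraph.circulantGraph ({1} : Set (ZMod k)))).edgeSet |
      (e : Sym2 _) ∈ p.edges}, Set.range ((drawing hk hodd).arc e)) =
      Set.range (a.arc k) ∪ Set.range (b.arc k) ∪ Set.range (c.arc k) ∪ Set.range (d.arc k) := by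
  have sub : ∀ l : Strand, l.edge k ∈ p.edges → Set.range (l.arc k) ⊆
      ⋃ e ∈ {e : (mycielskiGraph (SimpleGraph.circulantGraph ({1} : Set (ZMod k)))).edgeSet |
        (e : Sym2 _) ∈ p.edges}, Set.range ((drawing hk hodd).arc e) := by
    intro l hl
    rw [← drawing_arc hk hodd l]
    exact Set.subset_biUnion_of_mem
      (u := fun e => Set.range ((drawing hk hodd).arc e)) hl
  refine Set.Subset.antisymm (Set.iUnion₂_subset ?_) ?_
  · intro e he
    rw [Set.mem_ofPred_eq, hp] at he
    simp only [List.mem_cons, List.not_mem_nil, or_false] at he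
    have harc : ∀ l : Strand, (e : Sym2 _) = l.edge k → (drawing hk hodd).arc e = l.arc k :=
      fun l h => arc_congr hk hodd ((edge_ofEdge hodd e).trans h)
    rcases he with h | h | h | h <;> rw [harc _ h]
    · exact fun x hx => Or.inl (Or.inl (Or.inl hx))
    · exact fun x hx => Or.inl (Or.inl (Or.inr hx))
    · exact fun x hx => Or.inl (Or.inr hx)
    · exact fun x hx => Or.inr hx
  · refine Set.union_subset (Set.union_subset (Set.union_subset ?_ ?_) ?_) ?_ <;>
      exact sub _ (by simp [hp])

end Strand

namespace Quad

variable {k : ℕ}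

theorem exists_isCycle (hk : 3 ≤ k) (hodd : Odd k) (c : Quad) :
    ∃ (v : _) (p : (mycielskiGraph (SimpleGraph.circulantGraph ({1} : Set (ZMod k)))).Walk v v),
      p.IsCycle ∧ p.length = 4 ∧
        c.map k '' (Set.Ioo (0 : I) 1 ×ˢ Set.Ioo (0 : I) 1)ᶜ =
          ⋃ e ∈ {e : (mycielskiGraph (SimpleGraph.circulantGraph ({1} : Set (ZMod k)))).edgeSet |
            (e : Sym2 _) ∈ p.edges}, Set.range ((Strand.drawing hk hodd).arc e) := by
  have h2 := Strand.two_ne_zero_of_le hk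
  have adj := fun l : Strand => Strand.edge_mem_edgeSet hk l
  have hm : ∀ m : ℤ, 2 * (m + 1) - 1 = 2 * m + 1 := fun m => by ring
  rcases c with m | m
  · have h1 := adj (.spoke m)
    have h3 := adj (.up m)
    have h4 := adj (.down (m + 1))
    have h5 := adj (.spoke (m + 1))
    simp only [Strand.edge, SimpleGraph.mem_edgeSet] at h1 h3 h4 h5
    rw [hm] at h4
    obtain ⟨p, hp, hp4, hpe⟩ := SimpleGraph.exists_isCycle_of_length_four h1 h3 h4.symm h5.symm
      (by simp [Strand.rimVertex]) (by
        simp only [Strand.copyVertex, ne_eq, Sum.inr.injEq, Option.some.injEq]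
        intro h
        push_cast at h
        exact h2 (by linear_combination -h))
    refine ⟨_, p, hp, hp4, ?_⟩
    rw [Strand.iUnion_drawing_arc hk hodd p (a := .spoke m) (b := .up m) (c := .down (m + 1))
      (d := .spoke (m + 1)), image_compl_inner]
    · ext x
      simp only [Set.mem_union]
      tauto
    · rw [hpe]
      simp only [Strand.edge, hm]
      rw [Sym2.eq_swap (a := Strand.rimVertex k (2 * m + 1)) (b := Strand.copyVertex k (2 * (m + 1))),
        Sym2.eq_swap (b := Sum.inr none)]
  · have h1 := adj (.up m)
    have h3 := adj (.rim (2 * m))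
    have h4 := adj (.rim (2 * m - 1))
    have h5 := adj (.down m)
    simp only [Strand.edge, SimpleGraph.mem_edgeSet] at h1 h3 h4 h5
    rw [sub_add_cancel] at h4
    obtain ⟨p, hp, hp4, hpe⟩ := SimpleGraph.exists_isCycle_of_length_four h1 h3.symm h4.symm h5.symm
      (by simp [Strand.rimVertex, Strand.copyVertex]) (by
        simp only [Strand.rimVertex, ne_eq, Sum.inl.injEq]
        intro h
        push_cast at h
        exact h2 (by linear_combination h))
    refine ⟨_, p, hp, hp4, ?_⟩
    rw [Strand.iUnion_drawing_arc hk hodd p (a := .up m) (b := .rim (2 * m)) (c := .rim (2 * m - 1))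
      (d := .down m), image_compl_outer]
    · ext x
      simp only [Set.mem_union]
      tauto
    · rw [hpe]
      simp only [Strand.edge, sub_add_cancel]
      rw [Sym2.eq_swap (a := Strand.rimVertex k (2 * m + 1)) (b := Strand.rimVertex k (2 * m)),
        Sym2.eq_swap (a := Strand.rimVertex k (2 * m)) (b := Strand.rimVertex k (2 * m - 1)),
        Sym2.eq_swap (a := Strand.rimVertex k (2 * m - 1)) (b := Strand.copyVertex k (2 * m))]

theorem range_diff_carrier (hk : 3 ≤ k) (hodd : Odd k) (c : Quad) :
    Set.range (c.map k) \ (Strand.drawing hk hodd).carrier =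
      c.map k '' (Set.Ioo (0 : I) 1 ×ˢ Set.Ioo (0 : I) 1) := by
  ext x
  constructor
  · rintro ⟨⟨z, rfl⟩, hx⟩
    refine ⟨z, ?_, rfl⟩
    by_contra hz
    have hmem := Set.mem_image_of_mem (c.map k) (Set.mem_compl hz)
    obtain ⟨v, p, -, -, h⟩ := exists_isCycle hk hodd c
    rw [h] at hmem
    obtain ⟨e, -, he⟩ := Set.mem_iUnion₂.1 hmem
    exact hx (Or.inr (Set.mem_iUnion.2 ⟨e, he⟩))
  · rintro ⟨⟨s, t⟩, ⟨hs, ht⟩, rfl⟩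
    refine ⟨⟨_, rfl⟩, fun h => c.not_isSkeletal hs ht ?_⟩
    rw [Strand.drawing_carrier] at h
    exact Strand.isSkeletal_of_mem (by omega) hodd (c.radius_mem s t) h

end Quad

/-- The `2 * k` closed cells cover the plane, and each loses exactly its boundary when the drawing
is removed; `connectedComponentIn_compl_eq` makes their interiors the faces. -/
theorem quadrangulates_mycielskiGraph_circulantGraph {k : ℕ} (hk : 3 ≤ k) (hodd : Odd k) :
    Quadrangulates (mycielskiGraph (SimpleGraph.circulantGraph ({1} : Set (ZMod k))))
      RealProjectivePlane := by
  have hk0 : 0 < k := by omega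
  refine ⟨Strand.drawing hk hodd, ?_⟩
  rintro _ ⟨x, hx, rfl⟩
  obtain ⟨i, hi⟩ := connectedComponentIn_compl_eq (C := (Strand.drawing hk hodd).carrier)
    (K := fun i => Set.range ((Quad.ofIndex k i).map k))
    (fun i => (isCompact_range (ContinuousMap.continuous _)).isClosed)
    (fun i => by
      rw [Quad.range_diff_carrier]
      exact (isPreconnected_Ioo.prod isPreconnected_Ioo).image _
        (ContinuousMap.continuous _).continuousOn)
    (fun i j hij => by
      rw [Quad.range_diff_carrier, Quad.range_diff_carrier]
      exact Quad.ofIndex_disjoint hk0 hij)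
    (fun y _ => by
      obtain ⟨r, hr, θ, rfl⟩ := exists_polarPoint hk0 y
      obtain ⟨c, z, hz⟩ := Quad.exists_mem_map (k := k) (θ := θ) hr
      obtain ⟨i, hi⟩ := Quad.exists_map_ofIndex hk0 c
      exact Set.mem_iUnion.2 ⟨i, z, (hi z).trans hz⟩)
    hx
  rw [hi]
  obtain ⟨v, p, hp, hp4, h⟩ := Quad.exists_isCycle hk hodd (Quad.ofIndex k i)
  exact ⟨v, p, (Quad.ofIndex k i).map k, hp, hp4,
    ((ContinuousMap.continuous _).isClosedEmbedding (Quad.map_injective hk _)).isEmbedding,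
    (Quad.range_diff_carrier hk hodd _).symm, h⟩

theorem Quadrangulates.of_iso {V W : Type*} {G : SimpleGraph V} {H : SimpleGraph W}
    {X : Type*} [TopologicalSpace X] (f : G ≃g H) (h : Quadrangulates G X) :
    Quadrangulates H X := by
  obtain ⟨D, hD⟩ := h
  let D' : GraphDrawing H X :=
    { point := D.point ∘ f.symm
      point_injective := D.point_injective.comp f.symm.injective
      arc := fun e => D.arc (f.symm.mapEdgeSet e)
      arc_isEmbedding := fun e => D.arc_isEmbedding _
      arc_ends := fun e => by
        rw [D.arc_ends, ← Sym2.map_map]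
        rfl
      arc_avoids := fun e => by
        rw [f.symm.surjective.range_comp]
        exact D.arc_avoids _
      arc_disjoint := fun e e' h => D.arc_disjoint _ _ (f.symm.mapEdgeSet.injective.ne h) }
  have hcarrier : D'.carrier = D.carrier := by
    refine congrArg₂ (· ∪ ·) (f.symm.surjective.range_comp _) ?_
    exact f.symm.mapEdgeSet.surjective.iUnion_comp (fun e => Set.range (D.arc e))
  refine ⟨D', fun F hF => ?_⟩
  obtain ⟨v, p, φ, hp, hp4, hφ, hint, hbd⟩ := hD F (by
    unfold GraphDrawing.IsFace at hF ⊢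
    rwa [hcarrier] at hF)
  refine ⟨f v, p.map f.toHom, φ, hp.map f.injective, by simpa using hp4, hφ, hint, ?_⟩
  rw [hbd, ← f.mapEdgeSet.surjective.iUnion_comp]
  refine Set.iUnion_congr fun e => ?_
  have hmem : ((f.mapEdgeSet e : H.edgeSet) : Sym2 W) ∈ (p.map f.toHom).edges ↔
      (e : Sym2 V) ∈ p.edges := by
    rw [SimpleGraph.Walk.edges_map]
    exact (List.mem_map_of_injective (Sym2.map.injective f.injective))
  have harc : D'.arc (f.mapEdgeSet e) = D.arc e :=
    congrArg D.arc (f.mapEdgeSet.symm_apply_apply e)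
  simp only [Set.mem_ofPred_eq, hmem, harc]

/-! ### The multiwheel is the Mycielski graph of its cycle. -/

section Cycle

variable {q : ℕ}

theorem Fin.add_one_ne_self (hq : 0 < q) (i : Fin (2 * q + 1)) : i + 1 ≠ i := by
  intro h
  have h1 : (1 : ZMod (2 * q + 1)) = 0 := add_eq_left.1 h
  exact Strand.two_ne_zero_of_le (k := 2 * q + 1) (by omega) (by linear_combination 2 * h1)

theorem Fin.add_one_add_one_ne_self (hq : 0 < q) (i : Fin (2 * q + 1)) : i + 1 + 1 ≠ i := by
  intro h
  rw [add_assoc] at h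
  have h1 : (1 : ZMod (2 * q + 1)) + 1 = 0 := add_eq_left.1 h
  exact Strand.two_ne_zero_of_le (k := 2 * q + 1) (by omega) (by linear_combination h1)

theorem SimpleGraph.cycleGraph_two_mul_add_one_adj (hq : 0 < q) {i j : Fin (2 * q + 1)} :
    (SimpleGraph.cycleGraph (2 * q + 1)).Adj i j ↔ j = i + 1 ∨ i = j + 1 := by
  rw [SimpleGraph.cycleGraph_eq_circulantGraph, SimpleGraph.circulantGraph_adj]
  simp only [Set.mem_singleton_iff, sub_eq_iff_eq_add']
  constructor
  · rintro ⟨-, h | h⟩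
    · exact Or.inr h
    · exact Or.inl h
  · rintro (rfl | rfl)
    · exact ⟨(Fin.add_one_ne_self hq i).symm, Or.inr rfl⟩
    · exact ⟨Fin.add_one_ne_self hq j, Or.inl rfl⟩

end Cycle

theorem wheelGraph_three : wheelGraph 3 = ⊤ := by
  ext u v
  rw [SimpleGraph.top_adj]
  revert u v
  have h : ∀ i j : Fin 3, (SimpleGraph.cycleGraph 3).Adj i j ↔ i ≠ j := by
    simp only [SimpleGraph.cycleGraph_adj]
    decide
  rintro (_ | i) (_ | j)
  · exact iff_of_false id (by simp)
  · exact iff_of_true trivial (by simp)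
  · exact iff_of_true trivial (by simp)
  · exact (h i j).trans (by simp)

/-- Small wheels are complete, so counting the ones that contain an edge means counting the ones
that contain both ends. -/
theorem map_wheelGraph_three_adj {V : Type*} (s : Option (Fin 3) ↪ V) (a b : V) :
    ((wheelGraph 3).map s).Adj a b ↔ a ≠ b ∧ a ∈ Set.range s ∧ b ∈ Set.range s := by
  rw [SimpleGraph.map_adj, wheelGraph_three]
  constructor
  · rintro ⟨u, v, h, rfl, rfl⟩
    exact ⟨s.injective.ne h, ⟨u, rfl⟩, ⟨v, rfl⟩⟩
  · rintro ⟨h, ⟨u, rfl⟩, ⟨v, rfl⟩⟩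
    exact ⟨u, v, fun h' => h (congrArg s h'), rfl, rfl⟩

namespace IsMultiwheelPattern

variable {V : Type*} {q : ℕ} {c : Option (Fin (2 * q + 1)) ↪ V}
  {s : Fin (2 * q + 1) → (Option (Fin 3) ↪ V)}

theorem notMem_range (h : IsMultiwheelPattern q c s) (i : Fin (2 * q + 1)) {o : Option (Fin 3)}
    (h0 : o ≠ none) (h1 : o ≠ some 1) : s i o ∉ Set.range c := by
  intro ho
  have := (h.meet_central i).subset ⟨⟨o, rfl⟩, ho⟩
  rcases this with h2 | h2
  · exact h0 ((s i).injective h2)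
  · exact h1 ((s i).injective h2)

theorem none_mem_range (h : IsMultiwheelPattern q c s) (i : Fin (2 * q + 1)) :
    s i none ∈ Set.range c :=
  ((h.meet_central i).symm.subset (Or.inl rfl)).2

/-- The matching is between unordered edges, but `s i (some 2)` is off the central wheel while every
small hub is on it; this excludes the swapped orientation. -/
theorem next (h : IsMultiwheelPattern q c s) (i : Fin (2 * q + 1)) :
    s i (some 1) = s (i + 1) none ∧ s i (some 2) = s (i + 1) (some 0) := by
  rcases Sym2.eq_iff.1 (h.cyclic i) with h1 | h1
  · exact h1
  · exact absurd (h1.2 ▸ h.none_mem_range (i + 1))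
      (h.notMem_range i (by simp) (by simp))

/-- If the orientation were swapped at `i`, the hub of the next small wheel would be `c (some i)`,
whereas it has to be an end of the rim edge at `i + 1`; with at least three rim vertices these
differ. -/
theorem hub_and_rim (hq : 0 < q) (h : IsMultiwheelPattern q c s) (i : Fin (2 * q + 1)) :
    s i none = c (some i) ∧ s i (some 1) = c (some (i + 1)) := by
  rcases Sym2.eq_iff.1 (h.middle i) with h1 | ⟨h1, h2⟩
  · exact h1
  · rw [(h.next i).1] at h2
    rcases Sym2.eq_iff.1 (h.middle (i + 1)) with ⟨h3, -⟩ | ⟨h3, -⟩ <;> rw [h2] at h3 <;>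
      have h3 := Option.some_injective _ (c.injective h3)
    · exact absurd h3.symm (Fin.add_one_ne_self hq i)
    · exact absurd h3.symm (Fin.add_one_add_one_ne_self hq i)

theorem inner_injective (h : IsMultiwheelPattern q c s) :
    Function.Injective fun i => s i (some 0) := by
  have step : ∀ i, s i (some 0) ≠ s (i + 1) (some 0) := by
    intro i hi
    rw [← (h.next i).2] at hi
    simpa using (s i).injective hi
  intro i j hij
  by_contra hne
  by_cases h1 : j = i + 1
  · subst h1
    exact step i hij
  by_cases h2 : i = j + 1
  · subst h2
    exact step j hij.symm
  exact Set.disjoint_left.1 (h.disjoint i j hne h1 h2) ⟨_, rfl⟩ ⟨_, hij.symm⟩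

/-- The vertex of the multiwheel that corresponds to a vertex of the Mycielski graph. -/
def toVertex (c : Option (Fin (2 * q + 1)) ↪ V) (s : Fin (2 * q + 1) → (Option (Fin 3) ↪ V)) :
    Fin (2 * q + 1) ⊕ Option (Fin (2 * q + 1)) → V :=
  Sum.elim (fun i => s i (some 0)) c

/-- With the orientations fixed, a small wheel consists of two consecutive pairs (rim vertex, added
vertex). From here on membership depends on the position only. -/
theorem range_eq (hq : 0 < q) (h : IsMultiwheelPattern q c s) (l : Fin (2 * q + 1)) :
    Set.range (s l) = {c (some l), s l (some 0), c (some (l + 1)), s (l + 1) (some 0)} := by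
  have h1 := h.hub_and_rim hq l
  have h2 := (h.next l).2
  ext x
  simp only [Set.mem_range, Set.mem_insert_iff, Set.mem_singleton_iff, Option.exists,
    Fin.exists_fin_succ, ← h1.1, ← h1.2, ← h2]
  simp [eq_comm]

theorem toVertex_bijective (hq : 0 < q) (h : IsMultiwheelPattern q c s) :
    Function.Bijective (toVertex c s) := by
  have hc : ∀ i o, s i (some 0) ≠ c o := fun i o hi =>
    h.notMem_range i (by simp) (by simp) ⟨o, hi.symm⟩
  refine ⟨?_, fun v => ?_⟩
  · rintro (i | o) (j | o') hij
    · exact congrArg _ (h.inner_injective hij)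
    · exact absurd hij (hc i o')
    · exact absurd hij.symm (hc j o)
    · exact congrArg _ (c.injective hij)
  · rcases h.cover.symm.subset (Set.mem_univ v) with ⟨o, rfl⟩ | hv
    · exact ⟨.inr o, rfl⟩
    · obtain ⟨l, hl⟩ := Set.mem_iUnion.1 hv
      rw [h.range_eq hq] at hl
      rcases hl with rfl | rfl | rfl | rfl
      · exact ⟨.inr (some l), rfl⟩
      · exact ⟨.inl l, rfl⟩
      · exact ⟨.inr (some (l + 1)), rfl⟩
      · exact ⟨.inl (l + 1), rfl⟩

theorem inl_mem_range (hq : 0 < q) (h : IsMultiwheelPattern q c s) (i l : Fin (2 * q + 1)) :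
    toVertex c s (.inl i) ∈ Set.range (s l) ↔ l = i ∨ l + 1 = i := by
  rw [h.range_eq hq]
  have hinj := (h.toVertex_bijective hq).1
  change toVertex c s (.inl i) ∈ ({toVertex c s (.inr (some l)), toVertex c s (.inl l),
    toVertex c s (.inr (some (l + 1))), toVertex c s (.inl (l + 1))} : Set V) ↔ _
  simp only [Set.mem_insert_iff, Set.mem_singleton_iff, hinj.eq_iff]
  simp [eq_comm]

theorem inr_some_mem_range (hq : 0 < q) (h : IsMultiwheelPattern q c s) (i l : Fin (2 * q + 1)) :
    toVertex c s (.inr (some i)) ∈ Set.range (s l) ↔ l = i ∨ l + 1 = i := by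
  rw [h.range_eq hq]
  have hinj := (h.toVertex_bijective hq).1
  change toVertex c s (.inr (some i)) ∈ ({toVertex c s (.inr (some l)), toVertex c s (.inl l),
    toVertex c s (.inr (some (l + 1))), toVertex c s (.inl (l + 1))} : Set V) ↔ _
  simp only [Set.mem_insert_iff, Set.mem_singleton_iff, hinj.eq_iff]
  simp [eq_comm]

theorem inr_none_notMem_range (hq : 0 < q) (h : IsMultiwheelPattern q c s)
    (l : Fin (2 * q + 1)) : toVertex c s (.inr none) ∉ Set.range (s l) := by
  rw [h.range_eq hq]
  have hinj := (h.toVertex_bijective hq).1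
  change toVertex c s (.inr none) ∉ ({toVertex c s (.inr (some l)), toVertex c s (.inl l),
    toVertex c s (.inr (some (l + 1))), toVertex c s (.inl (l + 1))} : Set V)
  simp only [Set.mem_insert_iff, Set.mem_singleton_iff, hinj.eq_iff]
  simp

end IsMultiwheelPattern

/-- The wheels of a multiwheel: the central one and the small ones. -/
def multiwheelFamily {V : Type*} {q : ℕ} (c : Option (Fin (2 * q + 1)) ↪ V)
    (s : Fin (2 * q + 1) → (Option (Fin 3) ↪ V)) (o : Option (Fin (2 * q + 1))) : SimpleGraph V :=
  match o with
  | none => (wheelGraph (2 * q + 1)).map c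
  | some i => (wheelGraph 3).map (s i)

/-- The small wheels that contain the positions `i` and `j`, together with the central wheel if `P`
holds, are odd in number exactly when `P` holds and `i`, `j` are not consecutive, or conversely. -/
theorem odd_ncard_consecutive {q : ℕ} (hq : 0 < q) (P : Prop) (i j : Fin (2 * q + 1))
    (T : Set (Option (Fin (2 * q + 1)))) (hnone : none ∈ T ↔ P)
    (hsome : ∀ l, some l ∈ T ↔ (l = i ∨ l + 1 = i) ∧ (l = j ∨ l + 1 = j)) :
    Odd T.ncard ↔ (¬ P ↔ (j = i + 1 ∨ i = j + 1)) := by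
  have ne1 := Fin.add_one_ne_self hq
  have ne2 := Fin.add_one_add_one_ne_self hq
  -- Consecutive positions share exactly one small wheel, because `k ≥ 3`. Equal positions share
  -- two, all others none.
  have single : ∀ a : Fin (2 * q + 1), (∀ l, some l ∈ T ↔ l = a) → (Odd T.ncard ↔ ¬ P) := by
    intro a ha
    by_cases hP : P
    · have : T = {none, some a} := by
        ext (_ | l)
        · simp [hnone, hP]
        · simp [ha]
      rw [this, Set.ncard_pair (by simp)]
      exact iff_of_false (by decide) (not_not.2 hP)
    · have : T = {some a} := by
        ext (_ | l)
        · simp [hnone, hP]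
        · simp [ha]
      rw [this, Set.ncard_singleton]
      simpa using hP
  by_cases h1 : j = i + 1
  · subst h1
    rw [single i fun l => ?_]
    · simp
    · rw [hsome]
      constructor
      · rintro ⟨h | h, h' | h'⟩
        · exact h
        · exact h
        · rw [← h] at h'
          exact absurd h'.symm (ne2 _)
        · exact add_right_cancel h'
      · rintro rfl
        exact ⟨Or.inl rfl, Or.inr rfl⟩
  by_cases h2 : i = j + 1
  · subst h2
    rw [single j fun l => ?_]
    · simp
    · rw [hsome]
      constructor
      · rintro ⟨h | h, h' | h'⟩
        · exact h'
        · subst h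
          exact absurd h' (ne2 _)
        · exact h'
        · exact add_right_cancel h
      · rintro rfl
        exact ⟨Or.inr rfl, Or.inl rfl⟩
  simp only [h1, h2, or_self, iff_false, not_not]
  by_cases h3 : i = j
  · subst h3
    have hs : ∀ l, some l ∈ T ↔ l = i ∨ l = i - 1 := by
      intro l
      rw [hsome, and_self, eq_sub_iff_add_eq]
    have hne : i ≠ i - 1 := fun h => ne1 i (eq_sub_iff_add_eq.1 h)
    by_cases hP : P
    · have : T = {none, some i, some (i - 1)} := by
        ext (_ | l)
        · simp [hnone, hP]
        · simp [hs]
      rw [this, Set.ncard_insert_of_notMem (by simp), Set.ncard_pair (by simpa using hne)]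
      simpa [hP] using (by decide : Odd 3)
    · have : T = {some i, some (i - 1)} := by
        ext (_ | l)
        · simp [hnone, hP]
        · simp [hs]
      rw [this, Set.ncard_pair (by simpa using hne)]
      exact iff_of_false (by decide) hP
  · have hs : ∀ l, some l ∉ T := by
      intro l hl
      rcases (hsome l).1 hl with ⟨h | h, h' | h'⟩
      · exact h3 (h ▸ h')
      · exact h1 (by rw [← h', h])
      · exact h2 (by rw [← h, h'])
      · exact h3 (h ▸ h')
    by_cases hP : P
    · have : T = {none} := by
        ext (_ | l)
        · simp [hnone, hP]
        · simp [hs]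
      rw [this, Set.ncard_singleton]
      simpa using hP
    · have : T = ∅ := by
        ext (_ | l)
        · simp [hnone, hP]
        · simp [hs]
      rw [this, Set.ncard_empty]
      simpa using hP

theorem IsMultiwheelPattern.edgeSumModTwo_adj {V : Type*} {q : ℕ} (hq : 0 < q)
    {c : Option (Fin (2 * q + 1)) ↪ V} {s : Fin (2 * q + 1) → (Option (Fin 3) ↪ V)}
    (h : IsMultiwheelPattern q c s) (u v : Fin (2 * q + 1) ⊕ Option (Fin (2 * q + 1))) :
    (edgeSumModTwo (multiwheelFamily c s)).Adj (toVertex c s u) (toVertex c s v) ↔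
      (mycielskiGraph (SimpleGraph.cycleGraph (2 * q + 1))).Adj u v := by
  have hinj := (h.toVertex_bijective hq).1
  have hcyc := fun i j => SimpleGraph.cycleGraph_two_mul_add_one_adj hq (i := i) (j := j)
  by_cases huv : u = v
  · subst huv
    simp
  have hne : toVertex c s u ≠ toVertex c s v := hinj.ne huv
  have hsmall : ∀ l, (multiwheelFamily c s (some l)).Adj (toVertex c s u) (toVertex c s v) ↔
      toVertex c s u ∈ Set.range (s l) ∧ toVertex c s v ∈ Set.range (s l) := fun l =>
    (map_wheelGraph_three_adj _ _ _).trans (and_iff_right hne)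
  have hcentral : ∀ o o', (multiwheelFamily c s none).Adj (toVertex c s (.inr o))
      (toVertex c s (.inr o')) ↔ (wheelGraph (2 * q + 1)).Adj o o' := fun o o' =>
    SimpleGraph.map_adj_apply
  have hcentral' : ∀ i w, ¬ (multiwheelFamily c s none).Adj (toVertex c s (.inl i)) w := by
    intro i w hw
    obtain ⟨o, -, -, ho, -⟩ := (SimpleGraph.map_adj _ _ _ _).1 hw
    exact h.notMem_range i (by simp) (by simp) ⟨o, ho⟩
  change Odd (Set.ncard _) ↔ _
  rcases u with i | _ | i <;> rcases v with j | _ | j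
  · rw [odd_ncard_consecutive hq False i j _ (iff_of_false (hcentral' i _) id) fun l =>
      (hsmall l).trans (and_congr (h.inl_mem_range hq i l) (h.inl_mem_range hq j l))]
    rw [not_false_iff, true_iff]
    exact (hcyc i j).symm
  · refine iff_of_false ?_ id
    rw [show {o | (multiwheelFamily c s o).Adj (toVertex c s (.inl i)) (toVertex c s (.inr none))}
      = ∅ from ?_]
    · simp
    · ext (_ | l)
      · exact iff_of_false (hcentral' i _) id
      · exact iff_of_false (fun hl => h.inr_none_notMem_range hq l ((hsmall l).1 hl).2) id
  · rw [odd_ncard_consecutive hq False i j _ (iff_of_false (hcentral' i _) id) fun l =>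
      (hsmall l).trans (and_congr (h.inl_mem_range hq i l) (h.inr_some_mem_range hq j l))]
    rw [not_false_iff, true_iff]
    exact (hcyc i j).symm
  · refine iff_of_false ?_ id
    rw [show {o | (multiwheelFamily c s o).Adj (toVertex c s (.inr none)) (toVertex c s (.inl j))}
      = ∅ from ?_]
    · simp
    · ext (_ | l)
      · exact iff_of_false (fun hw => hcentral' j _ (SimpleGraph.Adj.symm hw)) id
      · exact iff_of_false (fun hl => h.inr_none_notMem_range hq l ((hsmall l).1 hl).1) id
  · exact absurd rfl huv
  · refine iff_of_true ?_ trivial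
    rw [show {o | (multiwheelFamily c s o).Adj (toVertex c s (.inr none))
      (toVertex c s (.inr (some j)))} = {none} from ?_]
    · simp
    · ext (_ | l)
      · exact iff_of_true ((hcentral _ _).2 trivial) rfl
      · exact iff_of_false (fun hl => h.inr_none_notMem_range hq l ((hsmall l).1 hl).1) (by simp)
  · rw [odd_ncard_consecutive hq False i j _ (iff_of_false
      (fun hw => hcentral' j _ (SimpleGraph.Adj.symm hw)) id) fun l =>
      (hsmall l).trans (and_congr (h.inr_some_mem_range hq i l) (h.inl_mem_range hq j l))]
    rw [not_false_iff, true_iff]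
    exact (hcyc i j).symm
  · refine iff_of_true ?_ trivial
    rw [show {o | (multiwheelFamily c s o).Adj (toVertex c s (.inr (some i)))
      (toVertex c s (.inr none))} = {none} from ?_]
    · simp
    · ext (_ | l)
      · exact iff_of_true ((hcentral _ _).2 trivial) rfl
      · exact iff_of_false (fun hl => h.inr_none_notMem_range hq l ((hsmall l).1 hl).2) (by simp)
  -- Here the central wheel contributes exactly when the positions are consecutive, so it cancels
  -- the one common small wheel, and no two copies become adjacent.
  · rw [odd_ncard_consecutive hq (j = i + 1 ∨ i = j + 1) i j _
      ((hcentral (some i) (some j)).trans (hcyc i j)) fun l =>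
      (hsmall l).trans (and_congr (h.inr_some_mem_range hq i l) (h.inr_some_mem_range hq j l))]
    exact iff_of_false (by tauto) id

/-- The wheels placed on the vertices of the Mycielski graph of a cycle. -/
theorem isMultiwheelPattern_of_equiv {V : Type*} {q : ℕ} (hq : 0 < q)
    (f : Fin (2 * q + 1) ⊕ Option (Fin (2 * q + 1)) ≃ V) :
    ∃ (c : Option (Fin (2 * q + 1)) ↪ V) (s : Fin (2 * q + 1) → (Option (Fin 3) ↪ V)),
      IsMultiwheelPattern q c s ∧ IsMultiwheelPattern.toVertex c s = f := by
  have ne1 := Fin.add_one_ne_self hq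
  have ne2 := Fin.add_one_add_one_ne_self hq
  -- The only possible placement, by `range_eq`: the hub on copy `i`, and the rim on the cycle
  -- vertex `i`, copy `i + 1` and the cycle vertex `i + 1`.
  let g : Fin (2 * q + 1) → Option (Fin 3) → Fin (2 * q + 1) ⊕ Option (Fin (2 * q + 1)) :=
    fun i o => o.elim (.inr (some i)) ![.inl i, .inr (some (i + 1)), .inl (i + 1)]
  have hg : ∀ i, Function.Injective (g i) := by
    have h1 := fun i => (ne1 i).symm
    rintro i (_ | a) (_ | b)
    · exact fun _ => rfl
    · intro h
      fin_cases b <;> simp [g, h1] at h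
    · intro h
      fin_cases a <;> simp [g, ne1] at h
    · intro h
      fin_cases a <;> fin_cases b <;> simp [g, ne1, h1] at h ⊢
  have hrange : ∀ i, Set.range (g i) =
      {.inr (some i), .inl i, .inr (some (i + 1)), .inl (i + 1)} := by
    intro i
    ext x
    simp only [Set.mem_range, Set.mem_insert_iff, Set.mem_singleton_iff, Option.exists,
      Fin.exists_fin_succ]
    simp [g, eq_comm]
  have hrange' : ∀ i, Set.range (fun o => f (g i o)) = f '' Set.range (g i) :=
    fun i => Set.range_comp f (g i)
  have hc : Set.range (fun o => f (.inr o)) = f '' Set.range Sum.inr := Set.range_comp f Sum.inr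
  refine ⟨⟨fun o => f (.inr o), f.injective.comp Sum.inr_injective⟩,
    fun i => ⟨fun o => f (g i o), f.injective.comp (hg i)⟩, ⟨?_, ?_, ?_, ?_, ?_, ?_⟩, ?_⟩
  · refine Set.eq_univ_of_forall fun v => ?_
    obtain ⟨i | o, rfl⟩ := f.surjective v
    · exact Or.inr (Set.mem_iUnion.2 ⟨i, some 0, rfl⟩)
    · exact Or.inl ⟨o, rfl⟩
  · intro i
    rfl
  · intro i
    rfl
  · intro i
    simp only [Function.Embedding.coeFn_mk, hrange', hc]
    rw [← Set.image_inter f.injective, hrange]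
    change _ = ({f (.inr (some i)), f (.inr (some (i + 1)))} : Set V)
    rw [← Set.image_pair]
    congr 1
    ext (a | a) <;> simp
  · intro i
    simp only [Function.Embedding.coeFn_mk, hrange']
    rw [← Set.image_inter f.injective, hrange, hrange]
    change _ = ({f (.inr (some (i + 1))), f (.inl (i + 1))} : Set V)
    rw [← Set.image_pair]
    have h1 := ne1 i
    have h2 := ne1 (i + 1)
    have h3 := ne2 i
    congr 1
    ext (a | _ | a) <;> simp <;> grind
  · intro i j hij hji hij'
    simp only [Function.Embedding.coeFn_mk, hrange']
    rw [Set.disjoint_image_iff f.injective, hrange, hrange, Set.disjoint_left]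
    rintro (a | _ | a) <;> simp <;> grind
  · ext (i | o) <;> rfl

/-- For the converse the wheels are placed so that `toVertex` is the given isomorphism; the same
adjacency computation then yields equality of graphs on `V`. -/
theorem isGrotzschClass_iff {V : Type*} {q : ℕ} (hq : 0 < q) (G : SimpleGraph V) :
    IsGrotzschClass q G ↔
      Nonempty (G ≃g mycielskiGraph (SimpleGraph.cycleGraph (2 * q + 1))) := by
  constructor
  · rintro ⟨c, s, h, rfl⟩
    exact ⟨SimpleGraph.Iso.symm
      ⟨Equiv.ofBijective _ (h.toVertex_bijective hq), h.edgeSumModTwo_adj hq _ _⟩⟩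
  · rintro ⟨f⟩
    obtain ⟨c, s, h, hf⟩ := isMultiwheelPattern_of_equiv hq f.symm.toEquiv
    refine ⟨c, s, h, ?_⟩
    change G = edgeSumModTwo (multiwheelFamily c s)
    ext a b
    have := h.edgeSumModTwo_adj hq (f a) (f b)
    rw [hf] at this
    rw [show f.symm.toEquiv (f a) = a from f.symm_apply_apply a,
      show f.symm.toEquiv (f b) = b from f.symm_apply_apply b] at this
    rw [this, f.map_adj_iff]

/-! ### Criticality. -/

/-- Without isolated vertices, a subgraph that has all edges has all vertices, so a proper subgraph
misses an edge. -/
theorem isCriticalGraph_succ {V : Type*} {n : ℕ} {G : SimpleGraph V}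
    (hχ : G.chromaticNumber = (n + 1 : ℕ)) (hdeg : ∀ v, ∃ w, G.Adj v w)
    (hedge : ∀ u v, G.Adj u v → ∃ c : V → Fin n, ∀ a b, G.Adj a b → s(a, b) ≠ s(u, v) → c a ≠ c b) :
    IsCriticalGraph (n + 1) G := by
  refine ⟨hχ, fun H hH => ?_⟩
  obtain ⟨u, v, huv, hHuv⟩ : ∃ u v, G.Adj u v ∧ ¬ H.Adj u v := by
    by_contra! h
    refine hH ?_
    ext a b
    · obtain ⟨w, hw⟩ := hdeg a
      exact iff_of_true (h a w hw).fst_mem trivial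
    · exact ⟨fun hab => H.adj_sub hab, fun hab => h a b hab⟩
  obtain ⟨c, hc⟩ := hedge u v huv
  have hcol : H.coe.Colorable n := by
    refine ⟨SimpleGraph.Coloring.mk (fun a => c a) fun {a b} hab => ?_⟩
    have hab : H.Adj a b := hab
    refine hc a b (H.adj_sub hab) fun h => hHuv ?_
    rw [← SimpleGraph.Subgraph.mem_edgeSet, ← h]
    exact hab
  refine lt_of_le_of_lt hcol.chromaticNumber_le ?_
  exact_mod_cast Nat.lt_succ_self n

theorem mycielskiGraph_colorable {V : Type*} {G : SimpleGraph V} {n : ℕ} (h : G.Colorable n) :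
    (mycielskiGraph G).Colorable (n + 1) := by
  obtain ⟨c⟩ := h
  refine ⟨SimpleGraph.Coloring.mk (fun v => match v with
    | .inl a => (c a).castSucc
    | .inr (some a) => (c a).castSucc
    | .inr none => Fin.last n) ?_⟩
  rintro (a | _ | a) (b | _ | b) hab <;> first | exact hab.elim | skip
  · exact (Fin.castSucc_injective n).ne (c.valid hab)
  · exact (Fin.castSucc_injective n).ne (c.valid hab)
  · exact (Fin.castSucc_lt_last _).ne'
  · exact (Fin.castSucc_injective n).ne (c.valid hab)
  · exact (Fin.castSucc_lt_last _).ne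

/-- Give every vertex with the colour of the apex the colour of its copy. Copies avoid the apex
colour, so one colour is saved; two adjacent vertices are never both changed, and a copy differs
from the neighbours of its original. -/
theorem colorable_of_mycielskiGraph_colorable {V : Type*} {G : SimpleGraph V} {n : ℕ}
    (h : (mycielskiGraph G).Colorable (n + 1)) : G.Colorable n := by
  classical
  obtain ⟨c⟩ := h
  have hcopy : ∀ a, c (.inr (some a)) ≠ c (.inr none) := fun a =>
    c.valid (v := .inr (some a)) (w := .inr none) trivial
  let d : V → {x : Fin (n + 1) // x ≠ c (.inr none)} := fun a =>
    if h : c (.inl a) = c (.inr none) then ⟨c (.inr (some a)), hcopy a⟩ else ⟨c (.inl a), h⟩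
  have hd : ∀ {a b}, G.Adj a b → d a ≠ d b := by
    intro a b hab
    have h1 : c (.inl a) ≠ c (.inl b) := c.valid (v := .inl a) (w := .inl b) hab
    have h2 : c (.inl a) ≠ c (.inr (some b)) := c.valid (v := .inl a) (w := .inr (some b)) hab
    have h3 : c (.inr (some a)) ≠ c (.inl b) := c.valid (v := .inr (some a)) (w := .inl b) hab
    simp only [d]
    split_ifs with ha hb hb <;> simp only [ne_eq, Subtype.mk.injEq]
    · exact absurd (ha.trans hb.symm) h1
    · exact h3
    · exact h2
    · exact h1
  have := (SimpleGraph.Coloring.mk d hd).colorable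
  rwa [Fintype.card_subtype_compl, Fintype.card_fin, Fintype.card_subtype_eq,
    Nat.add_sub_cancel] at this

theorem chromaticNumber_mycielskiGraph {V : Type*} {G : SimpleGraph V} {n : ℕ}
    (h : G.chromaticNumber = (n + 1 : ℕ)) :
    (mycielskiGraph G).chromaticNumber = (n + 2 : ℕ) := by
  refine le_antisymm (mycielskiGraph_colorable
    (SimpleGraph.chromaticNumber_le_iff_colorable.1 h.le)).chromaticNumber_le ?_
  by_contra hlt
  rw [not_le] at hlt
  have h1 : (mycielskiGraph G).Colorable (n + 1) := by
    rw [← SimpleGraph.chromaticNumber_le_iff_colorable]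
    exact Order.lt_add_one_iff_of_not_isMax (by simp) |>.1 (by exact_mod_cast hlt)
  have h2 := (colorable_of_mycielskiGraph_colorable h1).chromaticNumber_le
  rw [h] at h2
  exact absurd (by exact_mod_cast h2 : n + 1 ≤ n) (by omega)

section CycleColoring

variable {q : ℕ}

/-- Reduces to four types of edges; it serves both for the edge that is deleted and for the edges on
which a colouring is checked. -/
theorem mycielskiGraph_cycleGraph_induction (hq : 0 < q)
    {P : Sym2 (Fin (2 * q + 1) ⊕ Option (Fin (2 * q + 1))) → Prop}
    (rim : ∀ j, P s(.inl j, .inl (j + 1)))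
    (up : ∀ j, P s(.inr (some j), .inl (j + 1)))
    (down : ∀ j, P s(.inr (some (j + 1)), .inl j))
    (spoke : ∀ j, P s(.inr none, .inr (some j))) (u v)
    (h : (mycielskiGraph (SimpleGraph.cycleGraph (2 * q + 1))).Adj u v) : P s(u, v) := by
  have hcyc := fun i j => SimpleGraph.cycleGraph_two_mul_add_one_adj hq (i := i) (j := j)
  rcases u with i | _ | i <;> rcases v with j | _ | j
  · rcases (hcyc i j).1 h with rfl | rfl
    · exact rim i
    · rw [Sym2.eq_swap]
      exact rim j
  · exact h.elim
  · rw [Sym2.eq_swap]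
    rcases (hcyc i j).1 h with rfl | rfl
    · exact down i
    · exact up j
  · exact h.elim
  · exact h.elim
  · exact spoke j
  · rcases (hcyc i j).1 h with rfl | rfl
    · exact up i
    · exact down j
  · rw [Sym2.eq_swap]
    exact spoke i
  · exact h.elim

/-- A colouring of the cycle in which only the base point `i` has colour `0`. -/
def baseColoring (i j : Fin (2 * q + 1)) : Fin 3 :=
  if (j - i).val = 0 then 0 else if (j - i).val % 2 = 1 then 1 else 2

theorem val_add_one_sub (i j : Fin (2 * q + 1)) :
    (j + 1 - i).val = if (j - i).val = 2 * q then 0 else (j - i).val + 1 := by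
  rw [add_sub_right_comm, Fin.val_add_one]
  simp only [Fin.ext_iff, Fin.val_last]

theorem baseColoring_add_one_ne (hq : 0 < q) (i j : Fin (2 * q + 1)) :
    baseColoring i j ≠ baseColoring i (j + 1) := by
  unfold baseColoring
  rw [val_add_one_sub]
  have := (j - i).2
  generalize (j - i).val = v at this ⊢
  split_ifs <;> first | contradiction | decide | omega

theorem baseColoring_ne_zero {i j : Fin (2 * q + 1)} (h : j ≠ i) : baseColoring i j ≠ 0 := by
  have h0 : (j - i).val ≠ 0 := fun h0 => h (sub_eq_zero.1 (Fin.ext h0))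
  unfold baseColoring
  rw [if_neg h0]
  split_ifs <;> decide

theorem baseColoring_self_add_one (hq : 0 < q) (i : Fin (2 * q + 1)) :
    baseColoring i (i + 1) = 1 := by
  have h := val_add_one_sub i i
  rw [sub_self, Fin.val_zero, if_neg (by omega)] at h
  unfold baseColoring
  rw [h]
  decide

/-- The base point sees colour 1 after it and 2 before it. Its copy can take one of them once the
edge to that neighbour is deleted. -/
theorem baseColoring_add_one_self (hq : 0 < q) (j : Fin (2 * q + 1)) :
    baseColoring (j + 1) j = 2 := by
  have h := val_add_one_sub (j + 1) j
  rw [sub_self, Fin.val_zero] at h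
  have h1 : (j - (j + 1)).val = 2 * q := by
    by_contra h2
    rw [if_neg h2] at h
    omega
  unfold baseColoring
  rw [h1, if_neg (by omega), if_neg (by omega)]

theorem exists_coloring_of_edge (hq : 0 < q) (u v)
    (h : (mycielskiGraph (SimpleGraph.cycleGraph (2 * q + 1))).Adj u v) :
    ∃ c : Fin (2 * q + 1) ⊕ Option (Fin (2 * q + 1)) → Fin 3, ∀ a b,
      (mycielskiGraph (SimpleGraph.cycleGraph (2 * q + 1))).Adj a b → s(a, b) ≠ s(u, v) →
        c a ≠ c b := by
  have ne1 := Fin.add_one_ne_self hq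
  have of_edges : ∀ (e : Sym2 _) (c : Fin (2 * q + 1) ⊕ Option (Fin (2 * q + 1)) → Fin 3),
      (∀ j, s(.inl j, .inl (j + 1)) ≠ e → c (.inl j) ≠ c (.inl (j + 1))) →
      (∀ j, s(.inr (some j), .inl (j + 1)) ≠ e → c (.inr (some j)) ≠ c (.inl (j + 1))) →
      (∀ j, s(.inr (some (j + 1)), .inl j) ≠ e → c (.inr (some (j + 1))) ≠ c (.inl j)) →
      (∀ j, s(.inr none, .inr (some j)) ≠ e → c (.inr none) ≠ c (.inr (some j))) →
      ∃ c : Fin (2 * q + 1) ⊕ Option (Fin (2 * q + 1)) → Fin 3, ∀ a b,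
        (mycielskiGraph (SimpleGraph.cycleGraph (2 * q + 1))).Adj a b → s(a, b) ≠ e →
          c a ≠ c b := by
    intro e c h1 h2 h3 h4
    refine ⟨c, fun a b hab hne => ?_⟩
    have := mycielskiGraph_cycleGraph_induction hq (P := fun e' => e' ≠ e → ¬ (e'.map c).IsDiag)
      (by simpa using h1) (by simpa using h2) (by simpa using h3) (by simpa using h4) a b hab hne
    simpa using this
  have hb := baseColoring_add_one_ne hq
  revert h
  refine fun h => mycielskiGraph_cycleGraph_induction hq
    (P := fun e => ∃ c : Fin (2 * q + 1) ⊕ Option (Fin (2 * q + 1)) → Fin 3, ∀ a b,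
      (mycielskiGraph (SimpleGraph.cycleGraph (2 * q + 1))).Adj a b → s(a, b) ≠ e →
        c a ≠ c b) ?_ ?_ ?_ ?_ u v h
  · intro i
    -- Without this edge the cycle is a path, and the colours 1 and 2 suffice for it; the copies all
    -- get 0 and the apex 1.
    refine of_edges _ (Sum.elim (fun j => if (j - (i + 1)).val % 2 = 1 then 1 else 2)
      (fun o => o.elim 1 fun _ => 0)) ?_ ?_ ?_ ?_
    · intro j hj
      simp only [Sum.elim_inl]
      rw [val_add_one_sub]
      have hne : (j - (i + 1)).val ≠ 2 * q := by
        intro h2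
        have h3 := val_add_one_sub (i + 1) j
        rw [if_pos h2] at h3
        exact hj (by rw [add_right_cancel (sub_eq_zero.1 (Fin.ext h3))])
      rw [if_neg hne]
      generalize (j - (i + 1)).val = v
      split_ifs <;> first | contradiction | decide | omega
    · intro j _
      simp only [Sum.elim_inl, Sum.elim_inr, Option.elim]
      split_ifs <;> decide
    · intro j _
      simp only [Sum.elim_inl, Sum.elim_inr, Option.elim]
      split_ifs <;> decide
    · intro j _
      simp
  · intro i
    -- Copies repeat the colours of their originals and the apex has 0. Only the copy of `i` would
    -- conflict with the apex; it takes 1, the colour of the neighbour that it has lost.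
    refine of_edges _ (Sum.elim (baseColoring i)
      (fun o => o.elim 0 fun j => if j = i then 1 else baseColoring i j))
      (fun j _ => hb i j) ?_ ?_ ?_
    · intro j hj
      have hji : j ≠ i := by
        rintro rfl
        exact hj rfl
      simpa [hji] using hb i j
    · intro j _
      simp only [Sum.elim_inl, Sum.elim_inr, Option.elim]
      split_ifs with h1
      · rw [← h1, baseColoring_add_one_self hq]
        decide
      · exact (hb i j).symm
    · intro j _
      simp only [Sum.elim_inr, Option.elim]
      split_ifs with h1
      · decide
      · exact (baseColoring_ne_zero h1).symm
  · intro i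
    -- The mirror image: the copy of the base point `i + 1` takes 2, the colour of its lost
    -- neighbour `i`.
    refine of_edges _ (Sum.elim (baseColoring (i + 1))
      (fun o => o.elim 0 fun j => if j = i + 1 then 2 else baseColoring (i + 1) j))
      (fun j _ => hb (i + 1) j) ?_ ?_ ?_
    · intro j _
      simp only [Sum.elim_inl, Sum.elim_inr, Option.elim]
      split_ifs with h1
      · rw [h1, baseColoring_self_add_one hq]
        decide
      · exact hb (i + 1) j
    · intro j hj
      have hji : j ≠ i := by
        rintro rfl
        exact hj rfl
      simpa [hji] using (hb (i + 1) j).symm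
    · intro j _
      simp only [Sum.elim_inr, Option.elim]
      split_ifs with h1
      · decide
      · exact (baseColoring_ne_zero h1).symm
  · intro i
    -- The copy of `i` is the only one with colour 0, and its edge to the apex is the deleted one.
    refine of_edges _ (Sum.elim (baseColoring i) (fun o => o.elim 0 (baseColoring i)))
      (fun j _ => hb i j) (fun j _ => hb i j) (fun j _ => (hb i j).symm) fun j hj => ?_
    have hji : j ≠ i := by
      rintro rfl
      exact hj rfl
    exact (baseColoring_ne_zero hji).symm

end CycleColoring

theorem IsCriticalGraph.mycielskiGraph_cycleGraph {q : ℕ} (hq : 0 < q) :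
    IsCriticalGraph 4 (mycielskiGraph (SimpleGraph.cycleGraph (2 * q + 1))) := by
  refine isCriticalGraph_succ (chromaticNumber_mycielskiGraph (n := 2) ?_) ?_
    (exists_coloring_of_edge hq)
  · exact_mod_cast SimpleGraph.chromaticNumber_cycleGraph_of_odd (2 * q + 1) (by omega) ⟨q, rfl⟩
  · rintro (i | _ | i)
    · exact ⟨.inl (i + 1), (SimpleGraph.cycleGraph_two_mul_add_one_adj hq).2 (Or.inl rfl)⟩
    · exact ⟨.inr (some 0), trivial⟩
    · exact ⟨.inr none, trivial⟩

/-- A proper subgraph pulls back to a proper subgraph; a homomorphism into the pullback is enough to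
bound the chromatic number. -/
theorem IsCriticalGraph.of_iso {V W : Type*} {n : ℕ} {G : SimpleGraph V} {H : SimpleGraph W}
    (f : G ≃g H) (h : IsCriticalGraph n G) : IsCriticalGraph n H := by
  refine ⟨(SimpleGraph.chromaticNumber_congr f).symm.trans h.1, fun K hK => ?_⟩
  have hmem : ∀ a, a ∈ (K.comap f.toHom).verts ↔ f a ∈ K.verts := fun a => Iff.rfl
  have hadj : ∀ a b, (K.comap f.toHom).Adj a b ↔ G.Adj a b ∧ K.Adj (f a) (f b) :=
    fun a b => Iff.rfl
  have hne : K.comap f.toHom ≠ ⊤ := by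
    intro htop
    refine hK ?_
    ext a b
    · refine iff_of_true ?_ trivial
      rw [← f.apply_symm_apply a, ← hmem, htop]
      trivial
    · refine ⟨fun hab => K.adj_sub hab, fun hab => ?_⟩
      have : (K.comap f.toHom).Adj (f.symm a) (f.symm b) := by
        rw [htop]
        exact f.symm.map_adj_iff.2 hab
      simpa using ((hadj _ _).1 this).2
  let g : K.coe →g (K.comap f.toHom).coe :=
    { toFun := fun a => ⟨f.symm a, by rw [hmem, f.apply_symm_apply]; exact a.2⟩
      map_rel' := fun {a b} hab => by
        have hab : K.Adj a b := hab
        refine (hadj _ _).2 ⟨f.symm.map_adj_iff.2 (K.adj_sub hab), ?_⟩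
        simpa using hab }
  exact (SimpleGraph.chromaticNumber_mono_of_hom g).trans_lt (h.2 _ hne)

/-! ### The cases `q = 1` and `q = 2`, and the theorem. -/

/-- Replaces `Set.ncard` by a finite count that `decide` can evaluate. -/
theorem baseGraph_adj_iff (u v : Fin 7) : baseGraph.Adj u v ↔
    Odd (Finset.univ.filter fun i : Fin 3 => u ≠ v ∧
      u ∈ (![{0, 1, 2, 4}, {0, 2, 3, 5}, {0, 3, 1, 6}] i : Finset (Fin 7)) ∧
      v ∈ (![{0, 1, 2, 4}, {0, 2, 3, 5}, {0, 3, 1, 6}] i : Finset (Fin 7))).card := by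
  rw [← Set.ncard_coe_finset]
  change Odd (Set.ncard _) ↔ _
  congr! 2
  ext i
  simp only [SimpleGraph.fromRel_adj, Finset.coe_filter, Finset.mem_univ, true_and, Set.mem_ofPred_eq]
  tauto

/-- The vertices of the base graph in their role in the Mycielski graph of the triangle. -/
def baseGraphEquiv : Fin 3 ⊕ Option (Fin 3) ≃ Fin 7 where
  -- Each of 4, 5, 6 is the copy of the one vertex among 1, 2, 3 that is missing from its wheel.
  toFun := Sum.elim ![1, 2, 3] fun o => o.elim 0 ![5, 6, 4]
  invFun := ![.inr none, .inl 0, .inl 1, .inl 2, .inr (some 2), .inr (some 0), .inr (some 1)]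
  left_inv := by decide
  right_inv := by decide

/-- The vertices of the Grötzsch graph in their role in the Mycielski graph of the pentagon. -/
def grotzschGraphEquiv : Fin 5 ⊕ Option (Fin 5) ≃ Fin 11 where
  toFun := Sum.elim ![0, 1, 2, 3, 4] fun o => o.elim 10 ![5, 6, 7, 8, 9]
  invFun := ![.inl 0, .inl 1, .inl 2, .inl 3, .inl 4, .inr (some 0), .inr (some 1), .inr (some 2),
    .inr (some 3), .inr (some 4), .inr none]
  left_inv := by decide
  right_inv := by decide

instance {V : Type*} (G : SimpleGraph V) [DecidableRel G.Adj] :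
    DecidableRel (mycielskiGraph G).Adj := fun u v =>
  match u, v with
  | .inl u, .inl v => inferInstanceAs (Decidable (G.Adj u v))
  | .inl u, .inr (some v) => inferInstanceAs (Decidable (G.Adj u v))
  | .inr (some u), .inl v => inferInstanceAs (Decidable (G.Adj u v))
  | .inr (some _), .inr none => .isTrue trivial
  | .inr none, .inr (some _) => .isTrue trivial
  | .inl _, .inr none => .isFalse id
  | .inr none, .inl _ => .isFalse id
  | .inr none, .inr none => .isFalse id
  | .inr (some _), .inr (some _) => .isFalse id

/-- The base graph is the Mycielski graph of the triangle. -/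
def mycielskiGraphIsoBaseGraph : mycielskiGraph (SimpleGraph.cycleGraph 3) ≃g baseGraph where
  toEquiv := baseGraphEquiv
  map_rel_iff' := by
    intro u v
    rw [baseGraph_adj_iff]
    revert u v
    decide

/-- The Grötzsch graph is the Mycielski graph of the pentagon. -/
def mycielskiGraphIsoGrotzschGraph :
    mycielskiGraph (SimpleGraph.cycleGraph 5) ≃g grotzschGraph where
  toEquiv := grotzschGraphEquiv
  map_rel_iff' := by
    intro u v
    rw [grotzschGraph, SimpleGraph.fromEdgeSet_adj]
    simp only [Set.mem_insert_iff, Set.mem_singleton_iff]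
    revert u v
    decide

theorem mainTheorem2 (q : ℕ) (hq : 0 < q) {V : Type*} (G : SimpleGraph V) :
    (IsGrotzschClass q G →
      IsCriticalGraph 4 G ∧ Quadrangulates G RealProjectivePlane) ∧
    (IsGrotzschClass q G ↔
      Nonempty (G ≃g mycielskiGraph (SimpleGraph.cycleGraph (2 * q + 1)))) ∧
    (q = 1 → (IsGrotzschClass q G ↔ Nonempty (G ≃g baseGraph))) ∧
    (q = 2 → (IsGrotzschClass q G ↔ Nonempty (G ≃g grotzschGraph))) := by
  have hG := isGrotzschClass_iff hq G
  refine ⟨fun h => ?_, hG, ?_, ?_⟩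
  · obtain ⟨f⟩ := hG.1 h
    refine ⟨(IsCriticalGraph.mycielskiGraph_cycleGraph hq).of_iso f.symm, .of_iso f.symm ?_⟩
    rw [SimpleGraph.cycleGraph_eq_circulantGraph]
    -- `ZMod (2 * q + 1)` unfolds to `Fin (2 * q + 1)`, so the circulant graphs on both coincide
    -- definitionally.
    exact quadrangulates_mycielskiGraph_circulantGraph (k := 2 * q + 1) (by omega) ⟨q, rfl⟩
  · rintro rfl
    rw [hG]
    exact ⟨fun ⟨f⟩ => ⟨f.trans mycielskiGraphIsoBaseGraph⟩,
      fun ⟨f⟩ => ⟨f.trans mycielskiGraphIsoBaseGraph.symm⟩⟩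
  · rintro rfl
    rw [hG]
    exact ⟨fun ⟨f⟩ => ⟨f.trans mycielskiGraphIsoGrotzschGraph⟩,
      fun ⟨f⟩ => ⟨f.trans mycielskiGraphIsoGrotzschGraph.symm⟩⟩
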